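/- Let $\Lambda$ be a finitely generated abelian group, possibly with torsion, and let $\Sigma$ be a finite reduced root system together with elements realizing it on $\Lambda$: the roots are homomorphisms $a\colon\Lambda\to\mathbb Z$ (written $\lambda\mapsto\langle\lambda,a\rangle$), each root $a$ has a coroot $a^\vee\in\Lambda$ with $\langle a^\vee,a\rangle=2$, distinct roots have distinct coroots, the reflections $b\mapsto b-\langle a^\vee,b\rangle a$ and $\lambda\mapsto s_a(\lambda)=\lambda-\langle\lambda,a\rangle a^\vee$ permute the roots and, correspondingly, the coroots, and proportional roots are equal or opposite. Fix a base of simple roots of $\Sigma$, with set of positive roots $\Sigma^+$. Let $W_0\subset\mathrm{Aut}(\Lambda)$ be the Weyl group generated by the $s_a$, and let $$\tilde W=\Lambda\rtimes W_0=\{t^\lambda y\mid \lambda\in\Lambda,\ y\in W_0\}.$$ (The main example, which this setting axiomatizes, is the Iwahori--Weyl group of a connected reductive group $\mathbf G$ over $L=k((t))$, $k$ algebraically closed: $\Lambda=X_*(T)_{\Gamma_0}$ is the group of coinvariants, under the absolute Galois group $\Gamma_0$ of $L$, of the cocharacters of the centralizer $T$ of a maximal $L$-split torus, $\Sigma$ is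 the reduced root system whose affine Weyl group is the affine Weyl group $W_{\mathrm{af}}$ of $\mathbf G$, and the base is given by the Weyl chamber that contains the base alcove, once one of the special vertices of this alcove is taken as the origin.) The affine roots are the pairs $(a,k)\in\Sigma\times\mathbb Z$, regarded as affine functions $v\mapsto\langle v,a\rangle+k$ on $\Lambda\otimes\mathbb R$; $\tilde W$ acts on them by $t^\lambda y\cdot(a,k)=(ya,\,k-\langle\lambda,ya\rangle)$, and $(a,k)$ is positive if it is positive on the base alcove $\mathfrak a=\{v\mid 0<\langle v,a\rangle<1\text{ for all }a\in\Sigma^+\}$. The affine reflections are the elements $t^{-ka^\vee}s_a$ of $\tilde W$, and the affine simple reflections are those in the walls of $\mathfrak a$, i.e. in the hyperplanes $\langle v,a\rangle=0$ for $a$ simple and $\langle v,\theta\rangle=1$ for $\theta$ the highest root of an irreducible component of $\Sigma$. The length $\ell(w)$ of $w\in\tilde W$ is the number of positive affine roots that $w$ sends to negative ones, and the Bruhat order $\leqslant$ on $\tilde W$ is the partial order generated by the relations $x\leqslant xr$ for $x\in\tilde W$ and $r$ an affine reflection with $\ell(x)<\ell(xr)$. Let $\mu\in\Lambda$ be dominant,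 i.e. $\langle\mu,a\rangle\geqslant0$ for all simple roots $a$ (in the case of a reductive group, $\mu$ is the image in $X_*(T)_{\Gamma_0}$ of a dominant cocharacter of $T$), and let $$\mathrm{Adm}(\mu)=\{w\in\tilde W\mid w\leqslant t^{x(\mu)}\text{ for some }x\in W_0\}$$ be the $\mu$-admissible set. Let $K$ be a spherical set of affine simple reflections, i.e. one for which the subgroup $W_K\subset\tilde W$ generated by $K$ is finite, and let $w\in\mathrm{Adm}(\mu)$. Then the set $wW_K\cap\mathrm{Adm}(\mu)$ contains a unique maximal element for the Bruhat order. -/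

import Mathlib

open scoped Pointwise

noncomputable section

/-- A *based reduced root datum with torsion*: the combinatorial datum that a connected reductive
group `G` over `L = k((t))` (`k` algebraically closed), a maximal `L`-split torus `S` with
centralizer `T`, and a base alcove with a chosen special vertex define.

* `Λ` is the abelian group `X_*(T)_{Γ₀}` of coinvariants of the cocharacter group under the absolute
  Galois group; it is finitely generated and may have torsion, which is why Mathlib's
  `RootPairing` (whose two sides are in perfect duality) cannot be used;
* `root` enumerates the reduced root system `Σ`, regarded as functionals on `Λ`, and `coroot`
  enumerates the coroots, regarded as elements of `Λ` (the translation lattice of the affine Weyl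
  group of `Σ` is the subgroup of `Λ` that the coroots generate);
* `base` is the set of simple roots of the dominant chamber. -/
structure BasedRootDatum (ι Λ : Type*) [AddCommGroup Λ] where
  /-- The roots. -/
  root : ι ↪ Module.Dual ℤ Λ
  /-- The coroots. -/
  coroot : ι ↪ Λ
  root_coroot_two : ∀ i, root i (coroot i) = 2
  /-- The reflection in the `i`-th root permutes the roots, and the coroots in the same way. -/
  reflection_stable : ∀ i j, ∃ k,
    root k = root j - root j (coroot i) • root i ∧
    coroot k = coroot j - root i (coroot j) • coroot i
  /-- Proportional roots are equal or opposite. -/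
  reduced : ∀ i j, ¬ LinearIndependent ℤ ![root i, root j] → root i = root j ∨ root i = -root j
  /-- The indices of the simple roots. -/
  base : Set ι
  linearIndepOn_base : LinearIndepOn ℤ root base
  root_mem_or_neg_mem : ∀ i,
    root i ∈ AddSubmonoid.closure (root '' base) ∨ -root i ∈ AddSubmonoid.closure (root '' base)

namespace BasedRootDatum

variable {ι Λ : Type*} [AddCommGroup Λ] (D : BasedRootDatum ι Λ)

/-- The set of positive roots `Σ⁺`. -/
def posRoots : Set (Module.Dual ℤ Λ) :=
  {a | a ∈ Set.range D.root ∧ a ∈ AddSubmonoid.closure (D.root '' D.base)}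

/-- `D.root i` is the highest root of an irreducible component of `Σ`: a maximal element of `Σ` for
the order in which `a ≤ b` means that `b - a` is a sum of simple roots. -/
def IsHighestRoot (i : ι) : Prop :=
  ∀ j, D.root j - D.root i ∈ AddSubmonoid.closure (D.root '' D.base) → j = i

/-- Dominant elements of `Λ`. -/
def IsDominant (x : Λ) : Prop := ∀ i ∈ D.base, 0 ≤ D.root i x

/-- The reflection `x ↦ x - ⟨x, a⟩ a^∨` of `Λ`, for the `i`-th root `a`. -/
def reflection (i : ι) : Λ ≃ₗ[ℤ] Λ := Module.reflection (D.root_coroot_two i)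

/-- The finite Weyl group `W₀`. -/
def weylGroup : Subgroup (Λ ≃ₗ[ℤ] Λ) := Subgroup.closure (Set.range D.reflection)

/-- The reflections, as elements of `W₀`. -/
def weylReflection (i : ι) : D.weylGroup :=
  ⟨D.reflection i, Subgroup.subset_closure (Set.mem_range_self i)⟩

/-- The action of `W₀` on `Λ`, with `Λ` written multiplicatively. -/
def weylAction : D.weylGroup →* MulAut (Multiplicative Λ) where
  toFun y := AddEquiv.toMultiplicative (y : Λ ≃ₗ[ℤ] Λ).toAddEquiv
  map_one' := rfl
  map_mul' _ _ := rfl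

/-- The Iwahori--Weyl group `W̃ = Λ ⋊ W₀`. -/
def IwahoriWeyl : Type _ := Multiplicative Λ ⋊[D.weylAction] D.weylGroup

instance : Group D.IwahoriWeyl :=
  inferInstanceAs (Group (Multiplicative Λ ⋊[D.weylAction] D.weylGroup))

/-- The translation element `t^x` of `W̃`. -/
def transl (x : Λ) : D.IwahoriWeyl := SemidirectProduct.inl (Multiplicative.ofAdd x)

/-- The inclusion of `W₀` in `W̃`. -/
def ofWeyl (y : D.weylGroup) : D.IwahoriWeyl := SemidirectProduct.inr y

/-- Affine roots are pairs `(a, k)` of a root and an integer, regarded as the affine functions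
`v ↦ ⟨v, a⟩ + k`. Such a pair is positive, i.e. positive on the base alcove
`{v | 0 < ⟨v, a⟩ < 1 for all positive roots a}`, if `k ≥ 0` when `a` is a positive root and `k ≥ 1`
when it is a negative one. -/
def IsPosAffineRoot (p : Module.Dual ℤ Λ × ℤ) : Prop :=
  (p.1 ∈ D.posRoots ∧ 0 ≤ p.2) ∨ (-p.1 ∈ D.posRoots ∧ 1 ≤ p.2)

/-- The action of `w = t^x y` on affine roots: `w (a, k) = (y a, k - ⟨x, y a⟩)`, where `y a` is the
functional `v ↦ ⟨y⁻¹ v, a⟩`. -/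
def affineAct (w : D.IwahoriWeyl) (p : Module.Dual ℤ Λ × ℤ) : Module.Dual ℤ Λ × ℤ :=
  let x : Λ := Multiplicative.toAdd (SemidirectProduct.left w)
  let y : Λ ≃ₗ[ℤ] Λ := ((SemidirectProduct.right w : D.weylGroup) : Λ ≃ₗ[ℤ] Λ)
  let b : Module.Dual ℤ Λ := p.1 ∘ₗ (y.symm : Λ →ₗ[ℤ] Λ)
  (b, p.2 - b x)

/-- The length of `w ∈ W̃`: the number of positive affine roots that `w` makes non-positive.
Equivalently, the number of affine root hyperplanes that separate the base alcove from its image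
under `w`. -/
def length (w : D.IwahoriWeyl) : ℕ :=
  Set.ncard {p | D.IsPosAffineRoot p ∧ ¬ D.IsPosAffineRoot (D.affineAct w p)}

/-- The affine reflection `v ↦ v - (⟨v, a⟩ + k) a^∨` in the hyperplane `⟨v, a⟩ = -k`, for the `i`-th
root `a`, as the element `t^{-k a^∨} s_a` of `W̃`. -/
def affineReflection (i : ι) (k : ℤ) : D.IwahoriWeyl :=
  D.transl (-(k • D.coroot i)) * D.ofWeyl (D.weylReflection i)

/-- The affine simple reflections, i.e. the reflections in the walls of the base alcove: those in
the hyperplanes `⟨v, a⟩ = 0` for `a` a simple root and in the hyperplanes `⟨v, θ⟩ = 1` for `θ` the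
highest root of an irreducible component. -/
def simpleReflections : Set D.IwahoriWeyl :=
  {s | (∃ i ∈ D.base, s = D.affineReflection i 0) ∨
    ∃ i, D.IsHighestRoot i ∧ s = D.affineReflection i (-1)}

/-- A set of affine simple reflections is spherical if it generates a finite subgroup. -/
def IsSpherical (K : Set D.IwahoriWeyl) : Prop :=
  K ⊆ D.simpleReflections ∧ (Subgroup.closure K : Set D.IwahoriWeyl).Finite

/-- The elementary relation of the Bruhat order: `y = x r` for an affine reflection `r`, and
`ℓ(x) < ℓ(y)`. -/
def BruhatStep (x y : D.IwahoriWeyl) : Prop :=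
  (∃ (i : ι) (k : ℤ), y = x * D.affineReflection i k) ∧ D.length x < D.length y

lemma length_le_of_bruhat {x y : D.IwahoriWeyl} (h : Relation.ReflTransGen D.BruhatStep x y) :
    x = y ∨ D.length x < D.length y := by
  induction h with
  | refl => exact Or.inl rfl
  | tail _ h ih =>
    rcases ih with rfl | ih
    · exact Or.inr h.2
    · exact Or.inr (ih.trans h.2)

/-- The Bruhat order on `W̃`. -/
instance : PartialOrder D.IwahoriWeyl where
  le := Relation.ReflTransGen D.BruhatStep
  le_refl _ := Relation.ReflTransGen.refl
  le_trans _ _ _ := Relation.ReflTransGen.trans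
  le_antisymm x y hxy hyx := by
    rcases D.length_le_of_bruhat hxy with h | h
    · exact h
    · rcases D.length_le_of_bruhat hyx with h' | h'
      · exact h'.symm
      · exact absurd (h.trans h') (lt_irrefl _)

/-- The `μ`-admissible set `Adm(μ)`: the elements below `t^{x(μ)}` for some `x ∈ W₀`. -/
def admissible (m : Λ) : Set D.IwahoriWeyl :=
  {w | ∃ x : D.weylGroup, w ≤ D.transl ((x : Λ ≃ₗ[ℤ] Λ) m)}

end BasedRootDatum

end

/-! The intersection even has a greatest element. The idea is to translate the coset far away by
some `p = t^{nc}`, where the union of intervals `Adm(μ)` is traded for a single Bruhat interval.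

As `W_K` is finite, the coset `wW_K` has an element `z` of maximal length. Take a regular `c`
pointing from the base alcove towards its image under `z`; then lengths add in `p x` for all `n` and
all `x` in the coset (`exists_regular_isReducedMul`, `isReducedMul_of_coset`). Let `μ_c` be the
point of the orbit `W₀μ` in the closed chamber of `c`. For `n` large and `x` in the coset, `x ∈
Adm(μ)` if and only if `p x ≤ t^{μ_c} p`. The elements of the coset `p w W_K` below one fixed
element have a greatest one (`exists_greatest_in_coset`), and cancelling `p` (`le_of_mul_le_mul`)
carries it back to `wW_K`.

The equivalence comes from computing with products of lower intervals: `Iic a * Iic b = Iic (a * b)`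
when lengths add (`Iic_mul_Iic`), and `a` can be cancelled from `a x ∈ Iic a * B`
(`mem_of_mul_mem`). To get from `Adm(μ)` to the inequality, a translation is moved leftwards across
`Iic p`, one simple reflection at a time. Each crossing keeps its exponent, seen through the linear
part of the factor crossed, or reflects it towards the chamber of `c`, which increases an invariant
form against `c`. The form is bounded on orbits, so enough copies of `t^c` force the exponent to
become `μ_c` (`exists_isDominantFor_Iic_mul_subset`). For the converse it suffices that crossing in
the other direction stays in the orbit, so that `Adm(μ) * Iic p ⊆ Iic p * Adm(μ)`
(`admissible_mul_Iic_subset`).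

Since `W̃` need not be a Coxeter group, lengths and the Bruhat order are handled through inversions,
and inductions end at elements of length zero, which permute the positive affine roots. -/

noncomputable section

namespace BasedRootDatum

variable {ι Λ : Type*} [AddCommGroup Λ] (D : BasedRootDatum ι Λ)

/-! ### The permutation of the roots by a reflection -/

/-- The index of the image of the `j`-th root under the `i`-th reflection. -/
def reflIdx (i j : ι) : ι := (D.reflection_stable i j).choose

lemma root_reflIdx (i j : ι) :
    D.root (D.reflIdx i j) = D.root j - D.root j (D.coroot i) • D.root i :=
  (D.reflection_stable i j).choose_spec.1

lemma coroot_reflIdx (i j : ι) :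
    D.coroot (D.reflIdx i j) = D.coroot j - D.root i (D.coroot j) • D.coroot i :=
  (D.reflection_stable i j).choose_spec.2

lemma root_reflIdx_apply (i j : ι) (x : Λ) :
    D.root (D.reflIdx i j) x = D.root j x - D.root j (D.coroot i) * D.root i x := by
  simp [root_reflIdx]

lemma root_reflIdx_self (i : ι) : D.root (D.reflIdx i i) = -D.root i := by
  rw [root_reflIdx, root_coroot_two]; module

lemma coroot_reflIdx_self (i : ι) : D.coroot (D.reflIdx i i) = -D.coroot i := by
  rw [coroot_reflIdx, root_coroot_two]; module

lemma reflIdx_reflIdx (i j : ι) : D.reflIdx i (D.reflIdx i j) = j := by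
  apply D.root.injective
  rw [root_reflIdx, root_reflIdx_apply, root_reflIdx, root_coroot_two]
  module

/-- The permutation of the indices by a reflection. -/
def reflPerm (i : ι) : Equiv.Perm ι := Function.Involutive.toPerm _ (D.reflIdx_reflIdx i)

lemma reflection_apply (i : ι) (x : Λ) :
    D.reflection i x = x - D.root i x • D.coroot i := by
  simp [reflection, Module.reflection_apply]

lemma reflection_reflection (i : ι) (x : Λ) : D.reflection i (D.reflection i x) = x :=
  Module.involutive_reflection (D.root_coroot_two i) x

lemma reflection_symm (i : ι) : (D.reflection i).symm = D.reflection i := by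
  ext x
  rw [LinearEquiv.symm_apply_eq, reflection_reflection]

lemma root_apply_reflection (i j : ι) (x : Λ) :
    D.root j (D.reflection i x) = D.root (D.reflIdx i j) x := by
  rw [reflection_apply, root_reflIdx_apply, map_sub, map_smul, smul_eq_mul, mul_comm]

lemma coroot_reflIdx_eq (i j : ι) :
    D.coroot (D.reflIdx i j) = D.reflection i (D.coroot j) := by
  rw [reflection_apply, coroot_reflIdx]

lemma weyl_induction {p : (y : Λ ≃ₗ[ℤ] Λ) → y ∈ D.weylGroup → Prop} (one : p 1 (one_mem _))
    (mul : ∀ i y (hy : y ∈ D.weylGroup), p y hy →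
      p (D.reflection i * y) (mul_mem (D.weylReflection i).2 hy))
    {y : Λ ≃ₗ[ℤ] Λ} (hy : y ∈ D.weylGroup) : p y hy := by
  induction hy using Subgroup.closure_induction_left with
  | one => exact one
  | mul_left x hx y hy ih =>
    obtain ⟨i, rfl⟩ := hx
    exact mul i y hy ih
  | inv_mul_cancel x hx y hy ih =>
    obtain ⟨i, rfl⟩ := hx
    simp only [show (D.reflection i)⁻¹ = D.reflection i from D.reflection_symm i]
    exact mul i y hy ih

/-- The Weyl group permutes the roots and, correspondingly, the coroots. -/
lemma exists_weyl_index (y : Λ ≃ₗ[ℤ] Λ) (hy : y ∈ D.weylGroup) (j : ι) :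
    ∃ k, (∀ x, D.root k (y x) = D.root j x) ∧ D.coroot k = y (D.coroot j) := by
  induction hy using D.weyl_induction with
  | one => exact ⟨j, fun x => rfl, rfl⟩
  | mul i y _ hy =>
    obtain ⟨k, hk, hk'⟩ := hy
    refine ⟨D.reflIdx i k, fun x => ?_, by rw [coroot_reflIdx_eq, hk']; rfl⟩
    rw [← hk, LinearEquiv.mul_apply, root_apply_reflection, reflIdx_reflIdx]

/-! ### Positive roots -/

/-- The sums of simple roots. -/
def simpleCone : AddSubmonoid (Module.Dual ℤ Λ) := AddSubmonoid.closure (D.root '' D.base)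

lemma root_mem_simpleCone {j : ι} (hj : j ∈ D.base) : D.root j ∈ D.simpleCone :=
  AddSubmonoid.subset_closure (Set.mem_image_of_mem _ hj)

lemma root_ne_zero (i : ι) : D.root i ≠ 0 := by
  intro h
  have := D.root_coroot_two i
  simp [h] at this

lemma exists_coeff {f : Module.Dual ℤ Λ} (hf : f ∈ D.simpleCone) :
    ∃ c : ι →₀ ℤ, c ∈ Finsupp.supported ℤ ℤ D.base ∧ (∀ k, 0 ≤ c k) ∧
      Finsupp.linearCombination ℤ D.root c = f := by
  induction hf using AddSubmonoid.closure_induction with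
  | mem f hf =>
    obtain ⟨j, hj, rfl⟩ := hf
    refine ⟨Finsupp.single j 1, Finsupp.single_mem_supported ℤ 1 hj, fun k => ?_, by simp⟩
    exact Finsupp.single_nonneg.2 zero_le_one k
  | zero => exact ⟨0, Submodule.zero_mem _, fun k => le_rfl, by simp⟩
  | add f g _ _ hf hg =>
    obtain ⟨c, hc, hc', rfl⟩ := hf
    obtain ⟨e, he, he', rfl⟩ := hg
    exact ⟨c + e, Submodule.add_mem _ hc he, fun k => add_nonneg (hc' k) (he' k), by simp⟩

/-- A simple root spans an extremal ray of the cone of sums of simple roots. -/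
lemma eq_smul_of_add_eq_smul {f g : Module.Dual ℤ Λ} (hf : f ∈ D.simpleCone)
    (hg : g ∈ D.simpleCone) {j : ι} (hj : j ∈ D.base) {n : ℤ} (h : f + g = n • D.root j) :
    ∃ m : ℤ, f = m • D.root j := by
  obtain ⟨c, hc, hc', rfl⟩ := D.exists_coeff hf
  obtain ⟨e, he, he', rfl⟩ := D.exists_coeff hg
  have h0 : c + e - Finsupp.single j n = 0 := by
    refine linearIndepOn_iff.1 D.linearIndepOn_base _
      (Submodule.sub_mem _ (Submodule.add_mem _ hc he) (Finsupp.single_mem_supported ℤ n hj)) ?_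
    simp [h]
  refine ⟨c j, ?_⟩
  have h1 : c = Finsupp.single j (c j) := by
    ext k
    by_cases hk : j = k
    · subst hk; simp
    · have := DFunLike.congr_fun h0 k
      rw [Finsupp.sub_apply, Finsupp.add_apply, Finsupp.single_eq_of_ne' hk,
        Finsupp.zero_apply] at this
      rw [Finsupp.single_eq_of_ne' hk]
      linarith [hc' k, he' k]
  conv_lhs => rw [h1]
  simp

lemma eq_zero_of_add_eq_zero {f g : Module.Dual ℤ Λ} (hf : f ∈ D.simpleCone)
    (hg : g ∈ D.simpleCone) (h : f + g = 0) : f = 0 := by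
  obtain ⟨c, hc, hc', rfl⟩ := D.exists_coeff hf
  obtain ⟨e, he, he', rfl⟩ := D.exists_coeff hg
  have h0 : c + e = 0 := by
    refine linearIndepOn_iff.1 D.linearIndepOn_base _ (Submodule.add_mem _ hc he) ?_
    simp [h]
  have h1 : c = 0 := by
    ext k
    have := DFunLike.congr_fun h0 k
    simp only [Finsupp.coe_add, Pi.add_apply, Finsupp.coe_zero, Pi.zero_apply] at this ⊢
    linarith [hc' k, he' k]
  simp [h1]

/-- The `i`-th root is positive. -/
def IsPos (i : ι) : Prop := D.root i ∈ D.simpleCone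

lemma isPos_or (i : ι) : D.IsPos i ∨ -D.root i ∈ D.simpleCone := D.root_mem_or_neg_mem i

variable {D} in
lemma IsPos.not_neg {i : ι} (h : D.IsPos i) : -D.root i ∉ D.simpleCone := fun h' =>
  D.root_ne_zero i (D.eq_zero_of_add_eq_zero h h' (add_neg_cancel _))

lemma isPos_of_mem_base {j : ι} (hj : j ∈ D.base) : D.IsPos j := D.root_mem_simpleCone hj

lemma eq_or_eq_neg_of_smul {i j : ι} {a b : ℤ} (hab : a ≠ 0)
    (h : a • D.root i = b • D.root j) : D.root i = D.root j ∨ D.root i = -D.root j := by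
  refine D.reduced i j fun hl => hab ?_
  rw [LinearIndependent.pair_iff] at hl
  exact (hl a (-b) (by rw [h]; module)).1

lemma eq_of_smul {i j : ι} (hi : D.IsPos i) (hj : D.IsPos j) {a b : ℤ} (ha : a ≠ 0)
    (h : a • D.root i = b • D.root j) : i = j := by
  rcases D.eq_or_eq_neg_of_smul ha h with h | h
  · exact D.root.injective h
  · refine absurd ?_ hj.not_neg
    rw [← h]; exact hi

/-- A simple reflection permutes the positive roots other than the simple one. -/
lemma isPos_reflIdx {i j : ι} (hj : j ∈ D.base) (hi : D.IsPos i) (hij : i ≠ j) :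
    D.IsPos (D.reflIdx j i) := by
  refine (D.isPos_or _).resolve_right fun h => hij ?_
  rw [root_reflIdx] at h
  obtain ⟨m, hm⟩ := D.eq_smul_of_add_eq_smul hi h hj (n := D.root i (D.coroot j)) (by module)
  exact D.eq_of_smul hi (D.isPos_of_mem_base hj) one_ne_zero (by rw [one_smul, hm])

/-! ### The sum of the positive coroots -/

section Fintype
variable [Fintype ι]

open Classical in
/-- The sum of the positive coroots. -/
def rhoCheck : Λ := ∑ i with D.IsPos i, D.coroot i

/-- The simple reflection permutes the other positive coroots and changes the sign of their pairing
with the simple root, so only the simple coroot contributes to the sum. -/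
lemma root_rhoCheck {j : ι} (hj : j ∈ D.base) : D.root j D.rhoCheck = 2 := by
  classical
  have hjp : j ∈ Finset.univ.filter D.IsPos := by simpa using D.isPos_of_mem_base hj
  have hneg : ∀ i, D.root j (D.coroot (D.reflIdx j i)) = -D.root j (D.coroot i) := fun i => by
    rw [coroot_reflIdx, map_sub, map_smul, root_coroot_two, smul_eq_mul]; ring
  have hmem : ∀ i ∈ (Finset.univ.filter D.IsPos).erase j,
      D.reflIdx j i ∈ (Finset.univ.filter D.IsPos).erase j := by
    intro i hi
    rw [Finset.mem_erase, Finset.mem_filter] at hi ⊢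
    refine ⟨fun h => ?_, Finset.mem_univ _, D.isPos_reflIdx hj hi.2.2 hi.1⟩
    have h1 : i = D.reflIdx j j := by rw [← D.reflIdx_reflIdx j i, h]
    apply (D.isPos_of_mem_base hj).not_neg
    rw [← D.root_reflIdx_self, ← h1]
    exact hi.2.2
  have h0 : ∑ i ∈ (Finset.univ.filter D.IsPos).erase j, D.root j (D.coroot i) =
      ∑ i ∈ (Finset.univ.filter D.IsPos).erase j, -D.root j (D.coroot i) :=
    Finset.sum_nbij' (D.reflIdx j) (D.reflIdx j) hmem hmem (fun i _ => D.reflIdx_reflIdx j i)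
      (fun i _ => D.reflIdx_reflIdx j i) fun i _ => by rw [hneg, neg_neg]
  rw [Finset.sum_neg_distrib] at h0
  rw [rhoCheck, map_sum, ← Finset.add_sum_erase _ _ hjp, root_coroot_two]
  linarith

lemma simpleCone_rhoCheck {f : Module.Dual ℤ Λ} (hf : f ∈ D.simpleCone) :
    f = 0 ∨ 0 < f D.rhoCheck := by
  induction hf using AddSubmonoid.closure_induction with
  | mem f hf =>
    obtain ⟨j, hj, rfl⟩ := hf
    exact Or.inr (by rw [D.root_rhoCheck hj]; norm_num)
  | zero => exact Or.inl rfl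
  | add f g _ _ hf hg =>
    rcases hf with rfl | hf
    · simpa using hg
    · rcases hg with rfl | hg
      · right; simpa using hf
      · right; rw [LinearMap.add_apply]; exact add_pos hf hg

variable {D} in
lemma IsPos.rhoCheck_pos {i : ι} (h : D.IsPos i) : 0 < D.root i D.rhoCheck :=
  (D.simpleCone_rhoCheck h).resolve_left (D.root_ne_zero i)

lemma isPos_iff (i : ι) : D.IsPos i ↔ 0 < D.root i D.rhoCheck := by
  refine ⟨fun h => h.rhoCheck_pos, fun h => (D.isPos_or i).resolve_right fun h' => ?_⟩
  rcases D.simpleCone_rhoCheck h' with h0 | h0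
  · exact D.root_ne_zero i (neg_eq_zero.1 h0)
  · rw [LinearMap.neg_apply] at h0; linarith

lemma root_rhoCheck_ne_zero (i : ι) : D.root i D.rhoCheck ≠ 0 := by
  rcases D.isPos_or i with h | h
  · exact h.rhoCheck_pos.ne'
  · rcases D.simpleCone_rhoCheck h with h0 | h0
    · exact absurd (neg_eq_zero.1 h0) (D.root_ne_zero i)
    · rw [LinearMap.neg_apply] at h0; linarith

/-! ### The invariant bilinear form -/

/-- The Weyl group invariant form `(x, y) ↦ ∑ ⟨x, a⟩ ⟨y, a⟩`, the sum being over all roots `a`. -/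
def form (x y : Λ) : ℤ := ∑ i, D.root i x * D.root i y

lemma form_comm (x y : Λ) : D.form x y = D.form y x :=
  Finset.sum_congr rfl fun _ _ => mul_comm _ _

lemma form_sub_left (x y z : Λ) : D.form (x - y) z = D.form x z - D.form y z := by
  simp [form, sub_mul, Finset.sum_sub_distrib]

lemma form_smul_left (n : ℤ) (x z : Λ) : D.form (n • x) z = n * D.form x z := by
  simp [form, Finset.mul_sum, mul_assoc]

lemma form_smul_right (n : ℤ) (x z : Λ) : D.form x (n • z) = n * D.form x z := by
  rw [form_comm, form_smul_left, form_comm]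

lemma form_sub_sub (x y : Λ) :
    D.form (x - y) (x - y) = D.form x x - 2 * D.form x y + D.form y y := by
  rw [form_sub_left, D.form_comm x, D.form_comm y, form_sub_left, form_sub_left, D.form_comm y x]
  ring

lemma form_self_nonneg (x : Λ) : 0 ≤ D.form x x :=
  Finset.sum_nonneg fun _ _ => mul_self_nonneg _

lemma form_reflection (i : ι) (x y : Λ) :
    D.form (D.reflection i x) (D.reflection i y) = D.form x y := by
  simp only [form, root_apply_reflection]
  exact Equiv.sum_comp (D.reflPerm i) fun j => D.root j x * D.root j y

lemma form_weyl {y : Λ ≃ₗ[ℤ] Λ} (hy : y ∈ D.weylGroup) (x z : Λ) :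
    D.form (y x) (y z) = D.form x z := by
  induction hy using D.weyl_induction with
  | one => rfl
  | mul i y _ hy => rw [LinearEquiv.mul_apply, LinearEquiv.mul_apply, form_reflection, hy]

/-- Invariance under a reflection that negates its coroot. The form may be degenerate on `Λ`, but it
is positive on coroots, so this identity makes the signs of `⟨x, a⟩` and of the form against `a^∨`
agree. -/
lemma two_mul_form_coroot (i : ι) (x : Λ) :
    2 * D.form (D.coroot i) x = D.root i x * D.form (D.coroot i) (D.coroot i) := by
  have h := D.form_reflection i (D.coroot i) x
  have h1 : D.reflection i (D.coroot i) = (-1 : ℤ) • D.coroot i := by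
    rw [reflection_apply, root_coroot_two]; module
  rw [h1, form_smul_left, form_comm, reflection_apply, form_sub_left, form_smul_left,
    form_comm _ x] at h
  linarith

lemma form_coroot_self_pos (i : ι) : 0 < D.form (D.coroot i) (D.coroot i) := by
  refine Finset.sum_pos' (fun _ _ => mul_self_nonneg _) ⟨i, Finset.mem_univ _, ?_⟩
  rw [root_coroot_two]; norm_num

lemma form_coroot_pos_iff (i : ι) (x : Λ) : 0 < D.form (D.coroot i) x ↔ 0 < D.root i x := by
  have h := D.two_mul_form_coroot i x
  have h' := D.form_coroot_self_pos i
  constructor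
  · intro h1
    exact pos_of_mul_pos_left (by linarith) h'.le
  · intro h1
    have := mul_pos h1 h'
    linarith

lemma root_coroot_pos_comm {i j : ι} (h : 0 < D.root i (D.coroot j)) :
    0 < D.root j (D.coroot i) := by
  rwa [← form_coroot_pos_iff, form_comm, form_coroot_pos_iff]

/-- Semidefiniteness at `y x - z`. The bound is uniform in `y`, so extremal arguments on orbits need
no finiteness of `W₀`. -/
lemma two_mul_form_weyl_le {y : Λ ≃ₗ[ℤ] Λ} (hy : y ∈ D.weylGroup) (x z : Λ) :
    2 * D.form (y x) z ≤ D.form x x + D.form z z := by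
  have h := D.form_self_nonneg (y x - z)
  rw [form_sub_sub, form_weyl D hy] at h
  linarith

/-! ### Pairs of roots -/

/-- Two distinct roots cannot pair to numbers `≥ 2` in both ways. -/
lemma root_coroot_le_one {i j : ι} (hij : i ≠ j) (h : 2 ≤ D.root i (D.coroot j)) :
    D.root j (D.coroot i) ≤ 1 := by
  by_contra! h'
  have hi := D.two_mul_form_coroot i (D.coroot j)
  have hj := D.two_mul_form_coroot j (D.coroot i)
  have hi0 := D.form_coroot_self_pos i
  -- This vector is orthogonal to `coroot i`; its nonnegative square is the Cauchy–Schwarz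
  -- inequality that gives `m * n ≤ 4`.
  have hp := D.form_self_nonneg ((2 : ℤ) • D.coroot j - D.root i (D.coroot j) • D.coroot i)
  simp only [form_sub_sub, form_smul_left, form_smul_right] at hp
  rw [D.form_comm (D.coroot j) (D.coroot i)] at hj hp
  set m := D.root i (D.coroot j) with hm
  set n := D.root j (D.coroot i) with hn
  set F := D.form (D.coroot i) (D.coroot j)
  set P := D.form (D.coroot i) (D.coroot i)
  set Q := D.form (D.coroot j) (D.coroot j)
  have h4 : m * n ≤ 4 := by
    by_contra! h4
    have h5 : 0 ≤ m * P * (4 - m * n) := by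
      have : 0 ≤ n * (4 * Q - m * m * P) := mul_nonneg (by lia) (by nlinarith)
      nlinarith
    have h6 : 0 < m * P := mul_pos (by lia) hi0
    nlinarith
  have hm2 : m = 2 := by nlinarith
  have hn2 : n = 2 := by nlinarith
  -- If both pairings are 2, the product of the two reflections is unipotent and adds `2 (a_i -
  -- a_j)` each time; finiteness of the root system then forces `a_i = a_j`.
  have horb : ∀ k : ℕ, ∃ l, D.root l = D.root i + (2 * k : ℤ) • (D.root i - D.root j) := by
    intro k
    induction k with
    | zero => exact ⟨i, by simp⟩
    | succ k ih =>
      obtain ⟨l, hl⟩ := ih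
      refine ⟨D.reflIdx i (D.reflIdx j l), ?_⟩
      have h1 : D.root l (D.coroot j) = 2 := by
        simp [hl, ← hm, hm2, root_coroot_two]
      have h2 : D.root (D.reflIdx j l) (D.coroot i) = -2 := by
        rw [root_reflIdx_apply, h1, ← hn, hn2, hl]
        simp [← hn, hn2, root_coroot_two]
      rw [root_reflIdx, h2, root_reflIdx, h1, hl]
      push_cast
      module
  choose l hl using horb
  obtain ⟨a, b, hab, hlab⟩ := Finite.exists_ne_map_eq_of_infinite l
  refine hij (D.root.injective (sub_eq_zero.1 ?_))
  have h1 : (2 * a - 2 * b : ℤ) • (D.root i - D.root j) = 0 := by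
    have := hl a
    rw [hlab, hl b] at this
    rw [sub_smul, sub_eq_zero]
    exact (add_left_cancel this).symm
  refine (smul_eq_zero.1 h1).resolve_left fun h => hab ?_
  lia

end Fintype

/-! ### The action on affine roots -/

/-- The linear part of `w ∈ W̃`. -/
def lin (w : D.IwahoriWeyl) : Λ ≃ₗ[ℤ] Λ := ((SemidirectProduct.right w : D.weylGroup) : Λ ≃ₗ[ℤ] Λ)

/-- The translation part of `w ∈ W̃`. -/
def shift (w : D.IwahoriWeyl) : Λ := Multiplicative.toAdd (SemidirectProduct.left w)

lemma lin_mem (w : D.IwahoriWeyl) : D.lin w ∈ D.weylGroup := (SemidirectProduct.right w).2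

lemma iwahori_ext {v w : D.IwahoriWeyl} (h : D.shift v = D.shift w) (h' : D.lin v = D.lin w) :
    v = w :=
  SemidirectProduct.ext h (Subtype.ext h')

@[simp] lemma lin_one : D.lin 1 = 1 := rfl
@[simp] lemma shift_one : D.shift 1 = 0 := rfl
@[simp] lemma lin_mul (v w : D.IwahoriWeyl) : D.lin (v * w) = D.lin v * D.lin w := rfl
@[simp] lemma shift_mul (v w : D.IwahoriWeyl) :
    D.shift (v * w) = D.shift v + D.lin v (D.shift w) := rfl
@[simp] lemma lin_transl (x : Λ) : D.lin (D.transl x) = 1 := rfl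
@[simp] lemma shift_transl (x : Λ) : D.shift (D.transl x) = x := rfl
@[simp] lemma lin_ofWeyl (y : D.weylGroup) : D.lin (D.ofWeyl y) = y := rfl
@[simp] lemma shift_ofWeyl (y : D.weylGroup) : D.shift (D.ofWeyl y) = 0 := rfl

@[simp] lemma lin_affineReflection (i : ι) (k : ℤ) :
    D.lin (D.affineReflection i k) = D.reflection i := by
  simp only [affineReflection, lin_mul, lin_transl, one_mul, lin_ofWeyl]; rfl

@[simp] lemma shift_affineReflection (i : ι) (k : ℤ) :
    D.shift (D.affineReflection i k) = -(k • D.coroot i) := by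
  simp [affineReflection]

lemma transl_add (x y : Λ) : D.transl (x + y) = D.transl x * D.transl y := by
  apply D.iwahori_ext <;> simp

lemma transl_zero : D.transl 0 = 1 := by
  apply D.iwahori_ext <;> simp

lemma mul_transl (w : D.IwahoriWeyl) (x : Λ) :
    w * D.transl x = D.transl (D.lin w x) * w := by
  apply D.iwahori_ext
  · simp [add_comm]
  · simp

lemma affineAct_eq (w : D.IwahoriWeyl) (p : Module.Dual ℤ Λ × ℤ) :
    D.affineAct w p = (p.1 ∘ₗ ((D.lin w).symm : Λ →ₗ[ℤ] Λ),
      p.2 - p.1 ((D.lin w).symm (D.shift w))) := rfl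

@[simp] lemma affineAct_one (p : Module.Dual ℤ Λ × ℤ) : D.affineAct 1 p = p := by
  refine Prod.ext rfl ?_
  simp [affineAct_eq]

lemma affineAct_mul (v w : D.IwahoriWeyl) (p : Module.Dual ℤ Λ × ℤ) :
    D.affineAct (v * w) p = D.affineAct v (D.affineAct w p) := by
  simp only [affineAct_eq, lin_mul, shift_mul]
  refine Prod.ext ?_ ?_
  · rfl
  · change p.2 - p.1 ((D.lin w).symm ((D.lin v).symm _)) = _ - p.1 ((D.lin w).symm _)
    rw [map_add, map_add, map_add, LinearEquiv.symm_apply_apply]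
    ring

@[simp] lemma affineAct_inv_act (w : D.IwahoriWeyl) (p : Module.Dual ℤ Λ × ℤ) :
    D.affineAct w⁻¹ (D.affineAct w p) = p := by
  rw [← affineAct_mul, inv_mul_cancel, affineAct_one]

@[simp] lemma affineAct_act_inv (w : D.IwahoriWeyl) (p : Module.Dual ℤ Λ × ℤ) :
    D.affineAct w (D.affineAct w⁻¹ p) = p := by
  rw [← affineAct_mul, mul_inv_cancel, affineAct_one]

lemma affineAct_injective (w : D.IwahoriWeyl) : Function.Injective (D.affineAct w) :=
  Function.LeftInverse.injective (D.affineAct_inv_act w)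

lemma affineAct_add (w : D.IwahoriWeyl) (p q : Module.Dual ℤ Λ × ℤ) :
    D.affineAct w (p + q) = D.affineAct w p + D.affineAct w q := by
  simp only [affineAct_eq]
  refine Prod.ext (by simp [LinearMap.add_comp]) ?_
  simp only [Prod.snd_add, Prod.fst_add, LinearMap.add_apply]
  ring

/-- The action of `w ∈ W̃` on affine functions, as a homomorphism. -/
def actHom (w : D.IwahoriWeyl) : Module.Dual ℤ Λ × ℤ →+ Module.Dual ℤ Λ × ℤ :=
  AddMonoidHom.mk' (D.affineAct w) (D.affineAct_add w)

lemma affineAct_neg (w : D.IwahoriWeyl) (p : Module.Dual ℤ Λ × ℤ) :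
    D.affineAct w (-p) = -D.affineAct w p := map_neg (D.actHom w) p

lemma affineAct_sub_zsmul (w : D.IwahoriWeyl) (p q : Module.Dual ℤ Λ × ℤ) (n : ℤ) :
    D.affineAct w (p - n • q) = D.affineAct w p - n • D.affineAct w q :=
  (map_sub (D.actHom w) p (n • q)).trans (congrArg _ (map_zsmul (D.actHom w) n q))

/-- The `i`-th root shifted by `k`, as an affine root. -/
def aff (i : ι) (k : ℤ) : Module.Dual ℤ Λ × ℤ := (D.root i, k)

@[simp] lemma aff_fst (i : ι) (k : ℤ) : (D.aff i k).1 = D.root i := rfl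
@[simp] lemma aff_snd (i : ι) (k : ℤ) : (D.aff i k).2 = k := rfl

lemma affineAct_affineReflection (i : ι) (k : ℤ) (p : Module.Dual ℤ Λ × ℤ) :
    D.affineAct (D.affineReflection i k) p = p - p.1 (D.coroot i) • D.aff i k := by
  rw [affineAct_eq, lin_affineReflection, reflection_symm, shift_affineReflection]
  have h : ∀ x, D.reflection i x = x - D.root i x • D.coroot i := D.reflection_apply i
  refine Prod.ext ?_ ?_
  · ext x
    simp [h, mul_comm]
  · simp only [h, map_neg, map_smul, map_sub, root_coroot_two, Prod.snd_sub, Prod.smul_snd, aff_snd,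
      smul_eq_mul]
    ring

lemma affineAct_affineReflection_self (i : ι) (k : ℤ) :
    D.affineAct (D.affineReflection i k) (D.aff i k) = -D.aff i k := by
  rw [affineAct_affineReflection, aff_fst, root_coroot_two]; module

lemma affineReflection_mul_self (i : ι) (k : ℤ) :
    D.affineReflection i k * D.affineReflection i k = 1 := by
  apply D.iwahori_ext
  · simp [reflection_apply, root_coroot_two]
    module
  · ext x
    simp [reflection_reflection]

lemma mul_affineReflection_cancel (w : D.IwahoriWeyl) (i : ι) (k : ℤ) :
    w * D.affineReflection i k * D.affineReflection i k = w := by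
  rw [mul_assoc, affineReflection_mul_self, mul_one]

lemma affineReflection_mul_cancel (w : D.IwahoriWeyl) (i : ι) (k : ℤ) :
    D.affineReflection i k * (D.affineReflection i k * w) = w := by
  rw [← mul_assoc, affineReflection_mul_self, one_mul]

lemma affineReflection_inv (i : ι) (k : ℤ) :
    (D.affineReflection i k)⁻¹ = D.affineReflection i k :=
  inv_eq_of_mul_eq_one_left (D.affineReflection_mul_self i k)

/-- Affine roots are mapped to affine roots, and the reflections are conjugated accordingly. -/
lemma exists_affineAct_aff (w : D.IwahoriWeyl) (i : ι) (k : ℤ) :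
    ∃ j m, D.affineAct w (D.aff i k) = D.aff j m ∧
      w * D.affineReflection i k = D.affineReflection j m * w := by
  obtain ⟨j, hj, hj'⟩ := D.exists_weyl_index _ (D.lin_mem w) i
  have h0 : ∀ x, D.root i ((D.lin w).symm x) = D.root j x := fun x => by
    rw [← hj, LinearEquiv.apply_symm_apply]
  refine ⟨j, k - D.root j (D.shift w), ?_, ?_⟩
  · rw [affineAct_eq]
    refine Prod.ext (LinearMap.ext fun x => h0 x) ?_
    simp [h0]
  · apply D.iwahori_ext
    · simp [reflection_apply, hj']
      module
    · ext x
      simp [reflection_apply, hj', hj]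

lemma affineReflection_eq_of_aff {i j : ι} {k m : ℤ} (h : D.aff i k = D.aff j m) :
    D.affineReflection i k = D.affineReflection j m := by
  obtain ⟨h1, rfl⟩ := Prod.ext_iff.1 h
  rw [D.root.injective h1]; rfl

lemma conj_affineReflection {w : D.IwahoriWeyl} {i j : ι} {k m : ℤ}
    (h : D.affineAct w (D.aff i k) = D.aff j m) :
    w * D.affineReflection i k = D.affineReflection j m * w := by
  obtain ⟨j', m', h1, h2⟩ := D.exists_affineAct_aff w i k
  rw [h2, D.affineReflection_eq_of_aff (h1.symm.trans h)]

/-- The index of the opposite root. -/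
def negIdx (i : ι) : ι := D.reflIdx i i

@[simp] lemma root_negIdx (i : ι) : D.root (D.negIdx i) = -D.root i := D.root_reflIdx_self i
@[simp] lemma coroot_negIdx (i : ι) : D.coroot (D.negIdx i) = -D.coroot i := D.coroot_reflIdx_self i

lemma neg_aff (i : ι) (k : ℤ) : -D.aff i k = D.aff (D.negIdx i) (-k) := by
  simp [aff]

lemma affineReflection_negIdx (i : ι) (k : ℤ) :
    D.affineReflection (D.negIdx i) (-k) = D.affineReflection i k := by
  apply D.iwahori_ext
  · simp
  · ext x; simp [reflection_apply]

/-! ### Positive affine roots -/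

lemma mem_posRoots {i : ι} : D.root i ∈ D.posRoots ↔ D.IsPos i :=
  ⟨fun h => h.2, fun h => ⟨Set.mem_range_self i, h⟩⟩

lemma exists_aff_of_pos {p : Module.Dual ℤ Λ × ℤ} (h : D.IsPosAffineRoot p) :
    ∃ i, p = D.aff i p.2 := by
  rcases h with ⟨⟨⟨i, hi⟩, -⟩, -⟩ | ⟨⟨⟨i, hi⟩, -⟩, -⟩
  · exact ⟨i, Prod.ext hi.symm rfl⟩
  · exact ⟨D.negIdx i, Prod.ext (by simp [hi]) rfl⟩

lemma isPosAffineRoot_aff (i : ι) (k : ℤ) :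
    D.IsPosAffineRoot (D.aff i k) ↔ 1 ≤ k ∨ (0 ≤ k ∧ D.IsPos i) := by
  have h1 : -D.root i ∈ D.posRoots ↔ -D.root i ∈ D.simpleCone :=
    ⟨fun h => h.2, fun h => ⟨⟨D.negIdx i, D.root_negIdx i⟩, h⟩⟩
  rw [IsPosAffineRoot, aff_fst, aff_snd, mem_posRoots, h1]
  rcases D.isPos_or i with h | h
  · have := h.not_neg
    simp only [h, this]
    grind
  · have : ¬D.IsPos i := fun h' => h'.not_neg h
    simp only [h, this]
    grind

lemma isPos_negIdx_iff (i : ι) : D.IsPos (D.negIdx i) ↔ ¬D.IsPos i := by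
  rw [IsPos, root_negIdx]
  exact ⟨fun h h' => h'.not_neg h, fun h => (D.isPos_or i).resolve_left h⟩

lemma isPosAffineRoot_neg_aff (i : ι) (k : ℤ) :
    D.IsPosAffineRoot (-D.aff i k) ↔ ¬D.IsPosAffineRoot (D.aff i k) := by
  rw [neg_aff, isPosAffineRoot_aff, isPosAffineRoot_aff, isPos_negIdx_iff]
  grind

lemma not_pos_act_iff (w : D.IwahoriWeyl) (i : ι) (k : ℤ) :
    ¬D.IsPosAffineRoot (D.affineAct w (D.aff i k)) ↔
      D.IsPosAffineRoot (-D.affineAct w (D.aff i k)) := by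
  obtain ⟨j, m, h, -⟩ := D.exists_affineAct_aff w i k
  rw [h, isPosAffineRoot_neg_aff]

section Fintype
variable [Fintype ι]

/-- A bound for the values of the roots at the sum of the positive coroots. -/
def rhoBound : ℤ := 1 + ∑ i, |D.root i D.rhoCheck|

lemma abs_root_rhoCheck_lt (i : ι) : |D.root i D.rhoCheck| < D.rhoBound := by
  have := Finset.single_le_sum (f := fun i => |D.root i D.rhoCheck|) (fun _ _ => abs_nonneg _)
    (Finset.mem_univ i)
  rw [rhoBound]
  linarith

/-- A multiple of the value of affine functions at a point of the base alcove. -/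
def eval : Module.Dual ℤ Λ × ℤ →+ ℤ :=
  AddMonoidHom.mk' (fun p => D.rhoBound * p.2 + p.1 D.rhoCheck) fun p q => by
    simp only [Prod.snd_add, Prod.fst_add, LinearMap.add_apply]; ring

lemma eval_apply (p : Module.Dual ℤ Λ × ℤ) :
    D.eval p = D.rhoBound * p.2 + p.1 D.rhoCheck := rfl

/-- The base point is the sum of the positive coroots divided by `rhoBound`: there all roots have
absolute value below 1, so `k` decides the sign unless it is 0. Positivity of affine roots thus
becomes a linear inequality. -/
lemma eval_aff_pos_iff (i : ι) (k : ℤ) :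
    0 < D.eval (D.aff i k) ↔ D.IsPosAffineRoot (D.aff i k) := by
  rw [isPosAffineRoot_aff, eval_apply, aff_fst, aff_snd, isPos_iff]
  have h := abs_lt.1 (D.abs_root_rhoCheck_lt i)
  constructor
  · intro h0
    rcases lt_trichotomy k 0 with hk | rfl | hk
    · nlinarith
    · right; exact ⟨le_rfl, by simpa using h0⟩
    · exact Or.inl hk
  · rintro (h0 | ⟨h0, h1⟩)
    · nlinarith
    · nlinarith

lemma eval_aff_ne_zero (i : ι) (k : ℤ) : D.eval (D.aff i k) ≠ 0 := by
  rw [eval_apply, aff_fst, aff_snd]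
  have h := abs_lt.1 (D.abs_root_rhoCheck_lt i)
  have h' := D.root_rhoCheck_ne_zero i
  intro h0
  rcases lt_trichotomy k 0 with hk | rfl | hk
  · nlinarith
  · simp at h0; exact h' h0
  · nlinarith

lemma eval_pos {p : Module.Dual ℤ Λ × ℤ} (h : D.IsPosAffineRoot p) : 0 < D.eval p := by
  obtain ⟨i, hi⟩ := D.exists_aff_of_pos h
  rw [hi] at h ⊢
  exact (D.eval_aff_pos_iff _ _).2 h

lemma eval_act_neg_iff (w : D.IwahoriWeyl) (i : ι) (k : ℤ) :
    D.eval (D.affineAct w (D.aff i k)) < 0 ↔ ¬D.IsPosAffineRoot (D.affineAct w (D.aff i k)) := by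
  obtain ⟨j, m, h, -⟩ := D.exists_affineAct_aff w i k
  rw [h, ← eval_aff_pos_iff]
  have := D.eval_aff_ne_zero j m
  lia

/-! ### Lengths and reflections -/

/-- The inversions of `w`. -/
def inversions (w : D.IwahoriWeyl) : Set (Module.Dual ℤ Λ × ℤ) :=
  {p | D.IsPosAffineRoot p ∧ ¬D.IsPosAffineRoot (D.affineAct w p)}

omit [Fintype ι] in
lemma length_eq (w : D.IwahoriWeyl) : D.length w = (D.inversions w).ncard := rfl

/-- A positive `(a, k)` can become negative only if `k` is at most the pairing of the translation
part with the image of `a`. Finiteness matters because `Set.ncard` is 0 on infinite sets. -/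
lemma finite_inversions (w : D.IwahoriWeyl) : (D.inversions w).Finite := by
  refine Set.Finite.subset (Set.Finite.prod (Set.finite_range D.root)
    (Set.finite_Icc 0 (∑ i, |D.root i (D.shift w)|))) ?_
  rintro p ⟨hp, hp'⟩
  obtain ⟨i, hi⟩ := D.exists_aff_of_pos hp
  rw [hi] at hp hp'
  obtain ⟨j, hj, -⟩ := D.exists_weyl_index _ (D.lin_mem w) i
  have h1 : D.affineAct w (D.aff i p.2) = D.aff j (p.2 - D.root j (D.shift w)) := by
    have h0 : ∀ x, D.root i ((D.lin w).symm x) = D.root j x := fun x => by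
      rw [← hj, LinearEquiv.apply_symm_apply]
    rw [affineAct_eq]
    refine Prod.ext (LinearMap.ext fun x => h0 x) ?_
    simp [h0]
  rw [h1, isPosAffineRoot_aff] at hp'
  rw [isPosAffineRoot_aff] at hp
  have h2 := Finset.single_le_sum (f := fun i => |D.root i (D.shift w)|) (fun _ _ => abs_nonneg _)
    (Finset.mem_univ j)
  have h3 := le_abs_self (D.root j (D.shift w))
  push Not at hp'
  refine ⟨⟨i, by rw [hi]; rfl⟩, ?_, ?_⟩
  · lia
  · have := hp'.1
    linarith

/-- If `w` maps the positive affine root `β` to a positive one, then `ℓ(w) < ℓ(w s_β)`. -/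
lemma length_lt_mul {w : D.IwahoriWeyl} {i : ι} {k : ℤ} (hβ : D.IsPosAffineRoot (D.aff i k))
    (hw : D.IsPosAffineRoot (D.affineAct w (D.aff i k))) :
    D.length w < D.length (w * D.affineReflection i k) := by
  classical
  set r := D.affineReflection i k with hr
  have hrr : ∀ p, D.affineAct r (D.affineAct r p) = p := fun p => by
    rw [← affineAct_mul, hr, affineReflection_mul_self, affineAct_one]
  have hrβ : D.affineAct r (D.aff i k) = -D.aff i k := D.affineAct_affineReflection_self i k
  -- Applying the reflection where the result stays positive, and doing nothing elsewhere, injects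
  -- the inversions of `w` into those of `w * r`; the affine root `β` itself is an extra inversion
  -- outside the image.
  let f : Module.Dual ℤ Λ × ℤ → Module.Dual ℤ Λ × ℤ := fun p =>
    if D.IsPosAffineRoot (D.affineAct r p) then D.affineAct r p else p
  have hf : ∀ p ∈ D.inversions w, f p ∈ D.inversions (w * r) \ {D.aff i k} := by
    rintro p ⟨hp, hp'⟩
    obtain ⟨j, hj⟩ := D.exists_aff_of_pos hp
    by_cases h : D.IsPosAffineRoot (D.affineAct r p)
    · simp only [f, if_pos h]
      refine ⟨⟨h, by rwa [affineAct_mul, hrr]⟩, fun h' => ?_⟩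
      rw [Set.mem_singleton_iff] at h'
      have h1 : p = -D.aff i k := by rw [← hrr p, h', hrβ]
      rw [h1, isPosAffineRoot_neg_aff] at hp
      exact hp hβ
    · simp only [f, if_neg h]
      refine ⟨⟨hp, ?_⟩, fun h' => hp' ?_⟩
      · have h1 : D.eval (D.affineAct r p) < 0 := by
          rw [hj] at h ⊢; exact (D.eval_act_neg_iff _ _ _).2 h
        have h2 := D.eval_pos hp
        have h3 := D.eval_pos hβ
        have h4 := D.eval_pos hw
        have h5 : D.eval (D.affineAct w p) < 0 := by
          rw [hj] at hp' ⊢; exact (D.eval_act_neg_iff _ _ _).2 hp'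
        have h6 : D.affineAct r p = p - p.1 (D.coroot i) • D.aff i k :=
          D.affineAct_affineReflection i k p
        rw [h6, map_sub, map_zsmul, smul_eq_mul] at h1
        have h7 : D.eval (D.affineAct (w * r) p) < 0 := by
          rw [affineAct_mul, h6, affineAct_sub_zsmul, map_sub, map_zsmul, smul_eq_mul]
          -- At the base point `p` and `β` are positive but `p - n β` is negative, so `n > 0`; as `w
          -- p < 0 < w β` there, `w p - n w β` is negative too.
          have : 0 < p.1 (D.coroot i) := by
            by_contra! h8
            nlinarith
          nlinarith
        rw [hj] at h7 ⊢
        exact (D.eval_act_neg_iff _ _ _).1 h7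
      · rw [Set.mem_singleton_iff.1 h']; exact hw
  have hinj : Set.InjOn f (D.inversions w) := by
    rintro p ⟨hp, -⟩ q ⟨hq, -⟩ hpq
    simp only [f] at hpq
    split_ifs at hpq with h1 h2 h2
    · exact D.affineAct_injective r hpq
    · rw [← hpq, hrr] at h2; exact absurd hp h2
    · rw [hpq, hrr] at h1; exact absurd hq h1
    · exact hpq
  have hmem : D.aff i k ∈ D.inversions (w * r) := by
    refine ⟨hβ, ?_⟩
    rw [affineAct_mul, hrβ, affineAct_neg, ← not_pos_act_iff]
    exact not_not.2 hw
  rw [length_eq, length_eq]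
  calc (D.inversions w).ncard ≤ (D.inversions (w * r) \ {D.aff i k}).ncard :=
        Set.ncard_le_ncard_of_injOn f hf hinj ((D.finite_inversions _).subset Set.sdiff_subset)
    _ < _ := Set.ncard_sdiff_singleton_lt_of_mem hmem (D.finite_inversions _)

lemma length_mul_lt {w : D.IwahoriWeyl} {i : ι} {k : ℤ} (hβ : D.IsPosAffineRoot (D.aff i k))
    (hw : ¬D.IsPosAffineRoot (D.affineAct w (D.aff i k))) :
    D.length (w * D.affineReflection i k) < D.length w := by
  have := D.length_lt_mul (w := w * D.affineReflection i k) hβ (by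
    rw [affineAct_mul, affineAct_affineReflection_self, affineAct_neg, ← not_pos_act_iff]
    exact hw)
  rwa [mul_affineReflection_cancel] at this

lemma length_lt_mul_iff {w : D.IwahoriWeyl} {i : ι} {k : ℤ}
    (hβ : D.IsPosAffineRoot (D.aff i k)) :
    D.length w < D.length (w * D.affineReflection i k) ↔
      D.IsPosAffineRoot (D.affineAct w (D.aff i k)) :=
  ⟨fun h => by_contra fun h' => lt_asymm h (D.length_mul_lt hβ h'), D.length_lt_mul hβ⟩

lemma length_eq_zero_iff (w : D.IwahoriWeyl) :
    D.length w = 0 ↔ ∀ p, D.IsPosAffineRoot p → D.IsPosAffineRoot (D.affineAct w p) := by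
  rw [length_eq, Set.ncard_eq_zero (D.finite_inversions w), Set.eq_empty_iff_forall_notMem]
  simp [inversions]

omit [Fintype ι] in
/-- Multiplication by a reflection on the left. -/
lemma affineReflection_mul_eq (w : D.IwahoriWeyl) (i : ι) (k : ℤ) :
    ∃ j m, D.affineAct w (D.aff j m) = D.aff i k ∧
      D.affineReflection i k * w = w * D.affineReflection j m := by
  obtain ⟨j, m, h, -⟩ := D.exists_affineAct_aff w⁻¹ i k
  have h' : D.affineAct w (D.aff j m) = D.aff i k := by rw [← h, affineAct_act_inv]
  exact ⟨j, m, h', (D.conj_affineReflection h').symm⟩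

/-- `ℓ(w) < ℓ(s_β w)` if `w⁻¹ β` is positive. -/
lemma length_lt_left {w : D.IwahoriWeyl} {i : ι} {k : ℤ} (hβ : D.IsPosAffineRoot (D.aff i k))
    (hw : D.IsPosAffineRoot (D.affineAct w⁻¹ (D.aff i k))) :
    D.length w < D.length (D.affineReflection i k * w) := by
  obtain ⟨j, m, h, h'⟩ := D.affineReflection_mul_eq w i k
  rw [← h, affineAct_inv_act] at hw
  rw [h']
  exact D.length_lt_mul hw (by rwa [h])

lemma length_left_lt {w : D.IwahoriWeyl} {i : ι} {k : ℤ} (hβ : D.IsPosAffineRoot (D.aff i k))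
    (hw : ¬D.IsPosAffineRoot (D.affineAct w⁻¹ (D.aff i k))) :
    D.length (D.affineReflection i k * w) < D.length w := by
  have := D.length_lt_left (w := D.affineReflection i k * w) hβ (by
    rw [mul_inv_rev, affineReflection_inv, affineAct_mul, affineAct_affineReflection_self,
      affineAct_neg, ← not_pos_act_iff]
    exact hw)
  rwa [affineReflection_mul_cancel] at this

end Fintype

/-! ### Affine simple roots -/

/-- The pair `(i, k)` is an affine simple root: the reflection in it permutes the other positive
affine roots. -/
structure IsSimpleAt (i : ι) (k : ℤ) : Prop where
  pos : D.IsPosAffineRoot (D.aff i k)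
  not_pos_pred : ¬D.IsPosAffineRoot (D.aff i (k - 1))
  act_pos : ∀ p, D.IsPosAffineRoot p → p ≠ D.aff i k →
    D.IsPosAffineRoot (D.affineAct (D.affineReflection i k) p)

lemma affineAct_affineReflection_aff (i j : ι) (k m : ℤ) :
    D.affineAct (D.affineReflection i k) (D.aff j m) =
      D.aff (D.reflIdx i j) (m - D.root j (D.coroot i) * k) := by
  rw [affineAct_affineReflection]
  refine Prod.ext ?_ rfl
  exact (D.root_reflIdx i j).symm

lemma isSimpleAt_base {j : ι} (hj : j ∈ D.base) : D.IsSimpleAt j 0 := by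
  have hjp := D.isPos_of_mem_base hj
  refine ⟨?_, ?_, fun p hp hne => ?_⟩
  · rw [isPosAffineRoot_aff]; exact Or.inr ⟨le_rfl, hjp⟩
  · rw [isPosAffineRoot_aff]; lia
  · obtain ⟨i, hi⟩ := D.exists_aff_of_pos hp
    rw [hi] at hp hne ⊢
    rw [affineAct_affineReflection_aff, isPosAffineRoot_aff]
    rw [isPosAffineRoot_aff] at hp
    rcases hp with hp | ⟨hp, hip⟩
    · left; simpa using hp
    · by_cases hij : i = j
      · left
        subst hij
        have : p.2 ≠ 0 := fun h => hne (by rw [h])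
        lia
      · right
        exact ⟨by simpa using hp, D.isPos_reflIdx hj hip hij⟩

variable {D} in
lemma IsHighestRoot.isPos {t : ι} (ht : D.IsHighestRoot t) : D.IsPos t := by
  refine (D.isPos_or t).resolve_right fun h => ?_
  have h1 : D.negIdx t = t := ht _ (by
    rw [root_negIdx, sub_eq_add_neg]; exact add_mem h h)
  have h2 := D.root_negIdx t
  rw [h1] at h2
  have h3 := congrArg (fun f => f (D.coroot t)) h2
  simp [root_coroot_two] at h3

/-- A highest root is dominant. -/
lemma root_coroot_highest_nonneg {t i : ι} (ht : D.IsHighestRoot t) (hi : D.IsPos i) :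
    0 ≤ D.root i (D.coroot t) := by
  by_contra! hn
  set n := D.root i (D.coroot t) with hn'
  have h1 : D.root (D.reflIdx t i) - D.root t = D.root i + (-n - 1).toNat • D.root t := by
    rw [root_reflIdx, ← natCast_zsmul, Int.toNat_of_nonneg (by lia), ← hn']
    module
  have h2 : D.reflIdx t i = t := ht _ (by
    change _ ∈ D.simpleCone
    rw [h1]
    exact add_mem hi (nsmul_mem ht.isPos _))
  have h3 : i = t := D.eq_of_smul hi ht.isPos (a := 1) (b := 1 + n) one_ne_zero (by
    have := D.root_reflIdx t i
    rw [h2, ← hn'] at this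
    rw [add_smul, one_smul, one_smul]
    exact (eq_sub_iff_add_eq.1 this).symm)
  rw [hn', h3, root_coroot_two] at hn
  lia

section Fintype
variable [Fintype ι]

/-- The reflection in `1 - θ` adds `⟨θ^∨, a⟩` to the constant term of `(a, m)`. This is harmless for
`a > 0`, as `θ` is dominant. For `a = -c` with `c ≠ θ` positive, maximality of `θ` gives `⟨θ^∨, c⟩ ≤
1`; if the constant drops to 0, the new root `θ - c` is positive, again by maximality. -/
lemma isSimpleAt_highest {t : ι} (ht : D.IsHighestRoot t) : D.IsSimpleAt (D.negIdx t) 1 := by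
  have htp := ht.isPos
  refine ⟨?_, ?_, fun p hp hne => ?_⟩
  · rw [isPosAffineRoot_aff]; exact Or.inl le_rfl
  · rw [isPosAffineRoot_aff, isPos_negIdx_iff]; simp [htp]
  · obtain ⟨i, hi⟩ := D.exists_aff_of_pos hp
    rw [hi] at hp hne ⊢
    generalize p.2 = m at hp hne
    have hidx : D.reflIdx (D.negIdx t) i = D.reflIdx t i := by
      apply D.root.injective
      simp [root_reflIdx]
    rw [affineAct_affineReflection_aff, isPosAffineRoot_aff, hidx, coroot_negIdx, map_neg]
    rw [isPosAffineRoot_aff] at hp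
    have hfix : D.root i (D.coroot t) = 0 → D.reflIdx t i = i := fun h => by
      apply D.root.injective
      rw [root_reflIdx, h]; module
    by_cases hip : D.IsPos i
    · have hn := D.root_coroot_highest_nonneg ht hip
      rcases hn.eq_or_lt with h0 | h0
      · rw [hfix h0.symm, ← h0]; simpa using hp
      · left; lia
    · have hm : 1 ≤ m := by tauto
      have hcp : D.IsPos (D.negIdx i) := (D.isPos_negIdx_iff i).2 hip
      have hn := D.root_coroot_highest_nonneg ht hcp
      set c := D.negIdx i with hc
      have hci : D.root i = -D.root c := by rw [hc, root_negIdx, neg_neg]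
      rw [hci, LinearMap.neg_apply]
      rw [hci, LinearMap.neg_apply, neg_eq_zero] at hfix
      set n := D.root c (D.coroot t) with hn'
      by_cases hct : c = t
      · have hm1 : m ≠ 1 := fun h => hne (by
          rw [h]; refine Prod.ext ?_ rfl
          rw [aff_fst, aff_fst, hci, hct, root_negIdx])
        have : n = 2 := by rw [hn', hct, root_coroot_two]
        have : D.IsPos (D.reflIdx t i) := by
          have h : D.root (D.reflIdx t i) = D.root t := by
            rw [root_reflIdx, hci, hct, LinearMap.neg_apply, root_coroot_two]; module
          rw [IsPos, h]; exact htp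
        right
        exact ⟨by lia, this⟩
      · have hne2 : D.root c - D.root t ∉ D.simpleCone := fun h => hct (ht c h)
        rcases lt_trichotomy n 1 with h1 | h1 | h1
        · have h0 : n = 0 := by lia
          rw [hfix h0, h0]; left; lia
        · right
          refine ⟨by lia, (D.isPos_or _).resolve_right fun h => hne2 ?_⟩
          rw [root_reflIdx, hci, LinearMap.neg_apply, ← hn', h1] at h
          convert h using 1
          module
        -- With `n ≥ 2`, the other pairing is 1 and `θ - c` is a positive root. Then `s_θ(-c)`
        -- exceeds `θ` by `(θ - c) + (n - 2) θ`, so it equals `θ`, and `c` is a multiple of `θ`.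
        · exfalso
          have h2 : D.root t (D.coroot c) ≤ 1 := D.root_coroot_le_one hct (by lia)
          have h3 : 0 < D.root t (D.coroot c) := D.root_coroot_pos_comm (by lia)
          have h4 : D.root (D.reflIdx c t) = D.root t - D.root c := by
            rw [root_reflIdx, show D.root t (D.coroot c) = 1 by lia, one_smul]
          have h5 : D.IsPos (D.reflIdx c t) := (D.isPos_or _).resolve_right fun h => hne2 (by
            rw [h4, neg_sub] at h; exact h)
          have h6 : D.root (D.reflIdx t i) - D.root t =
              D.root (D.reflIdx c t) + (n - 2).toNat • D.root t := by
            rw [h4, root_reflIdx, hci, LinearMap.neg_apply, ← hn', ← natCast_zsmul,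
              Int.toNat_of_nonneg (by lia)]
            module
          have h7 : D.reflIdx t i = t := ht _ (by
            change _ ∈ D.simpleCone
            rw [h6]
            exact add_mem h5 (nsmul_mem htp _))
          refine hct (D.eq_of_smul hcp htp (a := 1) (b := n - 1) one_ne_zero ?_)
          have h8 := D.root_reflIdx t i
          rw [h7, hci, LinearMap.neg_apply, ← hn'] at h8
          rw [sub_smul, one_smul, one_smul]
          nth_rewrite 2 [h8]
          module

lemma exists_highest (i : ι) : ∃ t, D.IsHighestRoot t ∧ D.root t - D.root i ∈ D.simpleCone := by
  classical
  obtain ⟨t, ht, hmax⟩ := Finset.exists_max_image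
    (Finset.univ.filter fun t => D.root t - D.root i ∈ D.simpleCone) (fun t => D.root t D.rhoCheck)
    ⟨i, by simp [zero_mem]⟩
  simp only [Finset.mem_filter, Finset.mem_univ, true_and] at ht hmax
  refine ⟨t, fun j hj => ?_, ht⟩
  change _ ∈ D.simpleCone at hj
  have h1 := hmax j (by simpa using add_mem hj ht)
  rcases D.simpleCone_rhoCheck hj with h | h
  · exact D.root.injective (sub_eq_zero.1 h)
  · rw [LinearMap.sub_apply] at h; linarith

/-- Each element of nonzero length has a left descent. -/
lemma exists_left_descent {w : D.IwahoriWeyl} (hw : D.length w ≠ 0) :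
    ∃ i k, D.IsSimpleAt i k ∧ ¬D.IsPosAffineRoot (D.affineAct w⁻¹ (D.aff i k)) := by
  by_contra! hsimple
  apply hw
  -- Without a left descent, `f` is nonnegative on affine simple roots. These generate all positive
  -- affine roots, because `1 - a = (θ - a) + (1 - θ)` and the constant `1` is `a + (1 - a)`. So
  -- `w⁻¹`, and with it `w`, preserves positivity.
  let f : Module.Dual ℤ Λ × ℤ →+ ℤ := D.eval.comp (D.actHom w⁻¹)
  have hf : ∀ i k, D.IsSimpleAt i k → 0 ≤ f (D.aff i k) := fun i k h =>
    (D.eval_pos (hsimple i k h)).le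
  have hcone : ∀ g ∈ D.simpleCone, 0 ≤ f (g, 0) := by
    intro g hg
    induction hg using AddSubmonoid.closure_induction with
    | mem g hg =>
      obtain ⟨j, hj, rfl⟩ := hg
      exact hf j 0 (D.isSimpleAt_base hj)
    | zero => exact (map_zero f).ge
    | add g h _ _ hg hh =>
      have : ((g + h, 0) : Module.Dual ℤ Λ × ℤ) = (g, 0) + (h, 0) := by simp
      rw [this, map_add]; exact add_nonneg hg hh
  have hone : ∀ i : ι, 0 ≤ f (-D.root i, 1) := by
    intro i
    obtain ⟨t, ht, hti⟩ := D.exists_highest i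
    have h1 := hf _ _ (D.isSimpleAt_highest ht)
    have : ((-D.root i, 1) : Module.Dual ℤ Λ × ℤ) =
        (D.root t - D.root i, 0) + D.aff (D.negIdx t) 1 := by
      simp only [aff, root_negIdx, Prod.mk_add_mk, zero_add, Prod.mk.injEq, and_true]
      abel
    rw [this, map_add]
    exact add_nonneg (hcone _ hti) h1
  have hpos : ∀ p, D.IsPosAffineRoot p → 0 ≤ f p := by
    intro p hp
    obtain ⟨i, hi⟩ := D.exists_aff_of_pos hp
    rw [hi] at hp ⊢
    generalize p.2 = k at hp
    have hd : 0 ≤ f (0, 1) := by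
      rcases D.isPos_or i with h | h
      · have : ((0, 1) : Module.Dual ℤ Λ × ℤ) = (D.root i, 0) + (-D.root i, 1) := by simp
        rw [this, map_add]
        exact add_nonneg (hcone _ h) (hone i)
      · have : ((0, 1) : Module.Dual ℤ Λ × ℤ) =
            (-D.root i, 0) + (-D.root (D.negIdx i), 1) := by simp
        rw [this, map_add]
        exact add_nonneg (hcone _ h) (hone _)
    rw [isPosAffineRoot_aff] at hp
    by_cases hip : D.IsPos i
    · have : D.aff i k = (D.root i, 0) + k.toNat • ((0, 1) : Module.Dual ℤ Λ × ℤ) := by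
        rw [← natCast_zsmul, Int.toNat_of_nonneg (by lia)]; simp [aff]
      rw [this, map_add, map_nsmul]
      exact add_nonneg (hcone _ hip) (nsmul_nonneg hd _)
    · have hk : 1 ≤ k := by tauto
      have : D.aff i k = (-D.root (D.negIdx i), 1) +
          (k - 1).toNat • ((0, 1) : Module.Dual ℤ Λ × ℤ) := by
        rw [← natCast_zsmul, Int.toNat_of_nonneg (by lia)]; simp [aff]
      rw [this, map_add, map_nsmul]
      exact add_nonneg (hone _) (nsmul_nonneg hd _)
  have hinv : D.length w⁻¹ = 0 := by
    rw [length_eq_zero_iff]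
    intro p hp
    obtain ⟨i, hi⟩ := D.exists_aff_of_pos hp
    have h0 := hpos p hp
    rw [hi] at h0 ⊢
    by_contra h1
    exact absurd ((D.eval_act_neg_iff _ _ _).2 h1) (not_lt.2 h0)
  rw [length_eq_zero_iff] at hinv ⊢
  intro p hp
  obtain ⟨i, hi⟩ := D.exists_aff_of_pos hp
  rw [hi] at hp ⊢
  by_contra h1
  rw [not_pos_act_iff] at h1
  have h2 := hinv _ h1
  rw [affineAct_neg, affineAct_inv_act, isPosAffineRoot_neg_aff] at h2
  exact h2 hp

lemma exists_of_mem_simpleReflections {s : D.IwahoriWeyl} (hs : s ∈ D.simpleReflections) :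
    ∃ i k, s = D.affineReflection i k ∧ D.IsSimpleAt i k := by
  rcases hs with ⟨i, hi, rfl⟩ | ⟨i, hi, rfl⟩
  · exact ⟨i, 0, rfl, D.isSimpleAt_base hi⟩
  · exact ⟨D.negIdx i, 1, by rw [← affineReflection_negIdx, neg_neg], D.isSimpleAt_highest hi⟩

/-! ### The Bruhat order and simple reflections -/

omit [Fintype ι] in
lemma le_iff (x y : D.IwahoriWeyl) : x ≤ y ↔ Relation.ReflTransGen D.BruhatStep x y := Iff.rfl

omit [Fintype ι] in
variable {D} in
lemma BruhatStep.le {x y : D.IwahoriWeyl} (h : D.BruhatStep x y) : x ≤ y :=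
  Relation.ReflTransGen.single h

omit [Fintype ι] in
lemma eq_of_le_of_length_eq_zero {x y : D.IwahoriWeyl} (h : x ≤ y) (hy : D.length y = 0) :
    x = y := by
  rcases D.length_le_of_bruhat h with h | h
  · exact h
  · lia

/-- A Bruhat step is made by a positive affine root with positive image. -/
lemma bruhatStep_iff (x y : D.IwahoriWeyl) :
    D.BruhatStep x y ↔ ∃ i k, y = x * D.affineReflection i k ∧ D.IsPosAffineRoot (D.aff i k) ∧
      D.IsPosAffineRoot (D.affineAct x (D.aff i k)) := by
  constructor
  · rintro ⟨⟨i, k, rfl⟩, h⟩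
    by_cases hp : D.IsPosAffineRoot (D.aff i k)
    · exact ⟨i, k, rfl, hp, (D.length_lt_mul_iff hp).1 h⟩
    · have hp' : D.IsPosAffineRoot (D.aff (D.negIdx i) (-k)) := by
        rw [← neg_aff, isPosAffineRoot_neg_aff]; exact hp
      rw [← affineReflection_negIdx] at h ⊢
      exact ⟨_, _, rfl, hp', (D.length_lt_mul_iff hp').1 h⟩
  · rintro ⟨i, k, rfl, hp, hx⟩
    exact ⟨⟨i, k, rfl⟩, D.length_lt_mul hp hx⟩

/-- The lifting property. The step is witnessed by a positive affine root `γ` with `x γ` positive; a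
simple reflection keeps `x γ` positive unless `x γ` is its own affine simple root, and then `y = s
x`. -/
lemma bruhatStep_left {i : ι} {k : ℤ} (hs : D.IsSimpleAt i k) {x y : D.IwahoriWeyl}
    (h : D.BruhatStep x y) : y = D.affineReflection i k * x ∨
      D.BruhatStep (D.affineReflection i k * x) (D.affineReflection i k * y) := by
  obtain ⟨j, m, rfl, hp, hx⟩ := (D.bruhatStep_iff x y).1 h
  by_cases hne : D.affineAct x (D.aff j m) = D.aff i k
  · exact Or.inl (D.conj_affineReflection hne)
  · right
    rw [bruhatStep_iff]
    exact ⟨j, m, (mul_assoc _ _ _).symm, hp, by rw [affineAct_mul]; exact hs.act_pos _ hx hne⟩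

lemma bruhatStep_right {i : ι} {k : ℤ} (hs : D.IsSimpleAt i k) {x y : D.IwahoriWeyl}
    (h : D.BruhatStep x y) : y = x * D.affineReflection i k ∨
      D.BruhatStep (x * D.affineReflection i k) (y * D.affineReflection i k) := by
  obtain ⟨j, m, rfl, hp, hx⟩ := (D.bruhatStep_iff x y).1 h
  by_cases hne : D.aff j m = D.aff i k
  · exact Or.inl (by rw [D.affineReflection_eq_of_aff hne])
  · right
    rw [bruhatStep_iff]
    obtain ⟨j', m', h1, h2⟩ := D.exists_affineAct_aff (D.affineReflection i k) j m
    refine ⟨j', m', ?_, ?_, ?_⟩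
    · rw [mul_assoc, mul_assoc]
      have h3 := congrArg (fun w => w * D.affineReflection i k) h2
      simp only [mul_assoc, affineReflection_mul_self, mul_one] at h3
      rw [← h3, affineReflection_mul_cancel]
    · rw [← h1]; exact hs.act_pos _ hp hne
    · rw [← h1, ← affineAct_mul, mul_assoc, affineReflection_mul_self, mul_one]
      exact hx

/-- The subset `{1, s}` of `W̃`. -/
abbrev pair (i : ι) (k : ℤ) : Set D.IwahoriWeyl := {1, D.affineReflection i k}

omit [Fintype ι] in
lemma mem_pair_mul {i : ι} {k : ℤ} {B : Set D.IwahoriWeyl} {x : D.IwahoriWeyl} :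
    x ∈ D.pair i k * B ↔ x ∈ B ∨ D.affineReflection i k * x ∈ B := by
  rw [Set.mem_mul]
  constructor
  · rintro ⟨a, rfl | rfl, b, hb, rfl⟩
    · left; simpa using hb
    · right; simpa [affineReflection_mul_cancel] using hb
  · rintro (h | h)
    · exact ⟨1, by simp, x, h, one_mul x⟩
    · exact ⟨_, Or.inr rfl, _, h, D.affineReflection_mul_cancel x i k⟩

omit [Fintype ι] in
lemma mem_mul_pair {i : ι} {k : ℤ} {B : Set D.IwahoriWeyl} {x : D.IwahoriWeyl} :
    x ∈ B * D.pair i k ↔ x ∈ B ∨ x * D.affineReflection i k ∈ B := by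
  rw [Set.mem_mul]
  constructor
  · rintro ⟨b, hb, a, rfl | rfl, rfl⟩
    · left; simpa using hb
    · right; simpa [mul_affineReflection_cancel] using hb
  · rintro (h | h)
    · exact ⟨x, h, 1, by simp, mul_one x⟩
    · exact ⟨_, h, _, Or.inr rfl, D.mul_affineReflection_cancel x i k⟩

omit [Fintype ι] in
lemma isLowerSet_of_step {B : Set D.IwahoriWeyl}
    (h : ∀ x y, D.BruhatStep x y → y ∈ B → x ∈ B) : IsLowerSet B := by
  intro y x hxy hy
  rw [le_iff] at hxy
  induction hxy using Relation.ReflTransGen.head_induction_on with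
  | refl => exact hy
  | head hs _ ih => exact h _ _ hs ih

lemma isLowerSet_pair_mul {i : ι} {k : ℤ} (hs : D.IsSimpleAt i k) {B : Set D.IwahoriWeyl}
    (hB : IsLowerSet B) : IsLowerSet (D.pair i k * B) := by
  refine D.isLowerSet_of_step fun x y h hy => ?_
  rw [mem_pair_mul] at hy ⊢
  rcases D.bruhatStep_left hs h with rfl | h'
  · rw [affineReflection_mul_cancel] at hy
    exact hy.symm
  · exact hy.imp (hB h.le) (hB h'.le)

lemma isLowerSet_mul_pair {i : ι} {k : ℤ} (hs : D.IsSimpleAt i k) {B : Set D.IwahoriWeyl}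
    (hB : IsLowerSet B) : IsLowerSet (B * D.pair i k) := by
  refine D.isLowerSet_of_step fun x y h hy => ?_
  rw [mem_mul_pair] at hy ⊢
  rcases D.bruhatStep_right hs h with rfl | h'
  · rw [mul_affineReflection_cancel] at hy
    exact hy.symm
  · exact hy.imp (hB h.le) (hB h'.le)

lemma le_left {i : ι} {k : ℤ} (hs : D.IsSimpleAt i k) {a : D.IwahoriWeyl}
    (ha : D.IsPosAffineRoot (D.affineAct a⁻¹ (D.aff i k))) : a ≤ D.affineReflection i k * a := by
  obtain ⟨j, m, h, h'⟩ := D.affineReflection_mul_eq a i k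
  rw [h']
  refine BruhatStep.le ⟨⟨j, m, rfl⟩, ?_⟩
  rw [← h']
  exact D.length_lt_left hs.pos ha

lemma le_right {i : ι} {k : ℤ} (hs : D.IsSimpleAt i k) {a : D.IwahoriWeyl}
    (ha : D.IsPosAffineRoot (D.affineAct a (D.aff i k))) : a ≤ a * D.affineReflection i k :=
  BruhatStep.le ⟨⟨i, k, rfl⟩, D.length_lt_mul hs.pos ha⟩

lemma left_mul_le {i : ι} {k : ℤ} (hs : D.IsSimpleAt i k) {a x : D.IwahoriWeyl}
    (ha : D.IsPosAffineRoot (D.affineAct a⁻¹ (D.aff i k))) (hx : x ≤ a) :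
    D.affineReflection i k * x ≤ D.affineReflection i k * a := by
  rw [le_iff] at hx
  induction hx using Relation.ReflTransGen.head_induction_on with
  | refl => exact le_rfl
  | @head x y h hy ih =>
    rcases D.bruhatStep_left hs h with rfl | h'
    · exact le_trans hy (D.le_left hs ha)
    · exact h'.le.trans ih

lemma mul_right_le {i : ι} {k : ℤ} (hs : D.IsSimpleAt i k) {a x : D.IwahoriWeyl}
    (ha : D.IsPosAffineRoot (D.affineAct a (D.aff i k))) (hx : x ≤ a) :
    x * D.affineReflection i k ≤ a * D.affineReflection i k := by
  rw [le_iff] at hx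
  induction hx using Relation.ReflTransGen.head_induction_on with
  | refl => exact le_rfl
  | @head x y h hy ih =>
    rcases D.bruhatStep_right hs h with rfl | h'
    · exact le_trans hy (D.le_right hs ha)
    · exact h'.le.trans ih

/-- The lifting property as an identity of sets, which lets products of intervals be built and
rearranged one simple reflection at a time. -/
lemma Iic_left {i : ι} {k : ℤ} (hs : D.IsSimpleAt i k) {a : D.IwahoriWeyl}
    (ha : D.IsPosAffineRoot (D.affineAct a⁻¹ (D.aff i k))) :
    Set.Iic (D.affineReflection i k * a) = D.pair i k * Set.Iic a := by
  apply Set.Subset.antisymm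
  · intro x hx
    refine D.isLowerSet_pair_mul hs (isLowerSet_Iic a) hx ?_
    rw [mem_pair_mul, affineReflection_mul_cancel]
    exact Or.inr Set.self_mem_Iic
  · intro x hx
    rw [mem_pair_mul] at hx
    rcases hx with hx | hx
    · exact le_trans hx (D.le_left hs ha)
    · have := D.left_mul_le hs ha hx
      rwa [affineReflection_mul_cancel] at this

lemma Iic_right {i : ι} {k : ℤ} (hs : D.IsSimpleAt i k) {a : D.IwahoriWeyl}
    (ha : D.IsPosAffineRoot (D.affineAct a (D.aff i k))) :
    Set.Iic (a * D.affineReflection i k) = Set.Iic a * D.pair i k := by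
  apply Set.Subset.antisymm
  · intro x hx
    refine D.isLowerSet_mul_pair hs (isLowerSet_Iic a) hx ?_
    rw [mem_mul_pair, mul_affineReflection_cancel]
    exact Or.inr Set.self_mem_Iic
  · intro x hx
    rw [mem_mul_pair] at hx
    rcases hx with hx | hx
    · exact le_trans hx (D.le_right hs ha)
    · have := D.mul_right_le hs ha hx
      rwa [mul_affineReflection_cancel] at this

omit [Fintype ι] in
lemma subset_pair_mul (i : ι) (k : ℤ) (B : Set D.IwahoriWeyl) : B ⊆ D.pair i k * B :=
  fun _ hx => D.mem_pair_mul.2 (Or.inl hx)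

omit [Fintype ι] in
lemma subset_mul_pair (i : ι) (k : ℤ) (B : Set D.IwahoriWeyl) : B ⊆ B * D.pair i k :=
  fun _ hx => D.mem_mul_pair.2 (Or.inl hx)

omit [Fintype ι] in
lemma not_pos_left_iff (a : D.IwahoriWeyl) (i : ι) (k : ℤ) :
    ¬D.IsPosAffineRoot (D.affineAct a⁻¹ (D.aff i k)) ↔
      D.IsPosAffineRoot (D.affineAct (D.affineReflection i k * a)⁻¹ (D.aff i k)) := by
  rw [mul_inv_rev, affineReflection_inv, affineAct_mul, affineAct_affineReflection_self,
    affineAct_neg, not_pos_act_iff]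

omit [Fintype ι] in
lemma not_pos_right_iff (a : D.IwahoriWeyl) (i : ι) (k : ℤ) :
    ¬D.IsPosAffineRoot (D.affineAct a (D.aff i k)) ↔
      D.IsPosAffineRoot (D.affineAct (a * D.affineReflection i k) (D.aff i k)) := by
  rw [affineAct_mul, affineAct_affineReflection_self, affineAct_neg, not_pos_act_iff]

/-- If `sa < a`, the set of elements below `a` is stable under left multiplication by `s`. -/
lemma pair_mul_Iic_of_descent {i : ι} {k : ℤ} (hs : D.IsSimpleAt i k) {a : D.IwahoriWeyl}
    (ha : ¬D.IsPosAffineRoot (D.affineAct a⁻¹ (D.aff i k))) :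
    D.pair i k * Set.Iic a = Set.Iic a := by
  refine Set.Subset.antisymm (fun x hx => ?_) (D.subset_pair_mul i k _)
  have h1 := D.Iic_left hs ((D.not_pos_left_iff a i k).1 ha)
  rw [affineReflection_mul_cancel] at h1
  rw [h1, mem_pair_mul, mem_pair_mul, mem_pair_mul, affineReflection_mul_cancel] at hx
  rw [h1, mem_pair_mul]
  tauto

lemma mul_pair_Iic_of_descent {i : ι} {k : ℤ} (hs : D.IsSimpleAt i k) {a : D.IwahoriWeyl}
    (ha : ¬D.IsPosAffineRoot (D.affineAct a (D.aff i k))) :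
    Set.Iic a * D.pair i k = Set.Iic a := by
  refine Set.Subset.antisymm (fun x hx => ?_) (D.subset_mul_pair i k _)
  have h1 := D.Iic_right hs ((D.not_pos_right_iff a i k).1 ha)
  rw [mul_affineReflection_cancel] at h1
  rw [h1, mem_mul_pair, mem_mul_pair, mem_mul_pair, mul_affineReflection_cancel] at hx
  rw [h1, mem_mul_pair]
  tauto

/-- Induction on elements by left multiplication with simple reflections that increase the
length. -/
lemma left_induction {p : D.IwahoriWeyl → Prop} (zero : ∀ w, D.length w = 0 → p w)
    (mul : ∀ i k, D.IsSimpleAt i k → ∀ w, D.IsPosAffineRoot (D.affineAct w⁻¹ (D.aff i k)) →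
      p w → p (D.affineReflection i k * w)) (w : D.IwahoriWeyl) : p w := by
  induction hn : D.length w using Nat.strong_induction_on generalizing w with
  | _ n ih =>
    by_cases h0 : D.length w = 0
    · exact zero w h0
    · obtain ⟨i, k, hs, hd⟩ := D.exists_left_descent h0
      have h1 := mul i k hs _ ((D.not_pos_left_iff w i k).1 hd)
        (ih _ (hn ▸ D.length_left_lt hs.pos hd) _ rfl)
      rwa [affineReflection_mul_cancel] at h1

/-! ### Elements of length zero -/

lemma pos_act_iff_of_length_eq_zero {a : D.IwahoriWeyl} (ha : D.length a = 0)
    (p : Module.Dual ℤ Λ × ℤ) :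
    D.IsPosAffineRoot (D.affineAct a p) ↔ D.IsPosAffineRoot p := by
  have h0 := (D.length_eq_zero_iff a).1 ha
  refine ⟨fun h => ?_, h0 p⟩
  obtain ⟨i, hi⟩ := D.exists_aff_of_pos h
  obtain ⟨j, m, hj, -⟩ := D.exists_affineAct_aff a⁻¹ i (D.affineAct a p).2
  rw [← hi, affineAct_inv_act] at hj
  by_contra hn
  rw [hj, ← not_not (a := D.IsPosAffineRoot _), ← isPosAffineRoot_neg_aff, ← hj, not_not] at hn
  have h1 := h0 _ hn
  rw [affineAct_neg, hi, isPosAffineRoot_neg_aff, ← hi] at h1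
  exact h1 h

lemma length_inv_eq_zero {a : D.IwahoriWeyl} (ha : D.length a = 0) : D.length a⁻¹ = 0 := by
  rw [length_eq_zero_iff]
  intro p hp
  rwa [← D.pos_act_iff_of_length_eq_zero ha, affineAct_act_inv]

lemma mul_le_mul_of_length_eq_zero {a : D.IwahoriWeyl} (ha : D.length a = 0) {x y : D.IwahoriWeyl}
    (h : x ≤ y) : a * x ≤ a * y := by
  rw [le_iff] at h ⊢
  refine Relation.ReflTransGen.lift (a * ·) (fun x y hxy => ?_) _ _ h
  obtain ⟨i, k, rfl, hp, hx⟩ := (D.bruhatStep_iff x y).1 hxy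
  refine (D.bruhatStep_iff _ _).2 ⟨i, k, (mul_assoc _ _ _).symm, hp, ?_⟩
  rwa [affineAct_mul, D.pos_act_iff_of_length_eq_zero ha]

lemma mul_le_mul_right_of_length_eq_zero {a : D.IwahoriWeyl} (ha : D.length a = 0)
    {x y : D.IwahoriWeyl} (h : x ≤ y) : x * a ≤ y * a := by
  rw [le_iff] at h ⊢
  refine Relation.ReflTransGen.lift (· * a) (fun x y hxy => ?_) _ _ h
  obtain ⟨i, k, rfl, hp, hx⟩ := (D.bruhatStep_iff x y).1 hxy
  obtain ⟨j, m, h1, h2⟩ := D.affineReflection_mul_eq a i k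
  refine (D.bruhatStep_iff _ _).2 ⟨j, m, ?_, ?_, ?_⟩
  · change x * _ * a = x * a * _
    rw [mul_assoc, mul_assoc, h2]
  · rwa [← D.pos_act_iff_of_length_eq_zero ha, h1]
  · rwa [affineAct_mul, h1]

omit [Fintype ι] in
lemma Iic_of_length_eq_zero {a : D.IwahoriWeyl} (ha : D.length a = 0) :
    Set.Iic a = {a} :=
  Set.Subset.antisymm (fun _ hx => D.eq_of_le_of_length_eq_zero hx ha)
    (by rintro _ rfl; exact Set.self_mem_Iic)

omit [Fintype ι] in
lemma mem_singleton_mul {a x : D.IwahoriWeyl} {B : Set D.IwahoriWeyl} :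
    x ∈ ({a} : Set D.IwahoriWeyl) * B ↔ a⁻¹ * x ∈ B := by
  simp [Set.singleton_mul]

lemma isLowerSet_Iic_mul (a : D.IwahoriWeyl) {B : Set D.IwahoriWeyl} (hB : IsLowerSet B) :
    IsLowerSet (Set.Iic a * B) := by
  induction a using D.left_induction with
  | zero a ha =>
    rw [D.Iic_of_length_eq_zero ha]
    intro y x hxy hy
    rw [mem_singleton_mul] at hy ⊢
    exact hB (D.mul_le_mul_of_length_eq_zero (D.length_inv_eq_zero ha) hxy) hy
  | mul i k hs a ha ih =>
    rw [D.Iic_left hs ha, mul_assoc]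
    exact D.isLowerSet_pair_mul hs ih

/-! ### Products without cancellation -/

/-- The inversions of `b` are inversions of `ab`; in other words, lengths add in the product
`ab`. -/
def IsReducedMul (a b : D.IwahoriWeyl) : Prop :=
  ∀ p, D.IsPosAffineRoot p → ¬D.IsPosAffineRoot (D.affineAct b p) →
    ¬D.IsPosAffineRoot (D.affineAct (a * b) p)

-- Makes induction on the left factor possible. Only the affine simple root `α` of `s` can change
-- sign under `s` among positive roots: if `a b p = α`, then `b p = a⁻¹ α` is positive, and if `p =
-- -(a b)⁻¹ α` were positive, it would be an inversion of `b` but not of `s a b`.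
omit [Fintype ι] in
lemma IsReducedMul.of_mul_left {i : ι} {k : ℤ} (hs : D.IsSimpleAt i k) {a b : D.IwahoriWeyl}
    (h : D.IsReducedMul (D.affineReflection i k * a) b)
    (ha : D.IsPosAffineRoot (D.affineAct a⁻¹ (D.aff i k))) :
    D.IsReducedMul a b ∧ D.IsPosAffineRoot (D.affineAct (a * b)⁻¹ (D.aff i k)) := by
  constructor
  · intro p hp hbp hab
    have h1 := h p hp hbp
    rw [mul_assoc, affineAct_mul] at h1
    refine h1 (hs.act_pos _ hab fun h2 => hbp ?_)
    rw [← h2, affineAct_mul, affineAct_inv_act] at ha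
    exact ha
  · by_contra hn
    rw [not_pos_act_iff] at hn
    have h1 : D.affineAct b (-D.affineAct (a * b)⁻¹ (D.aff i k)) =
        -D.affineAct a⁻¹ (D.aff i k) := by
      rw [affineAct_neg, mul_inv_rev, affineAct_mul, affineAct_act_inv]
    refine h _ hn ?_ ?_
    · rw [h1, ← not_pos_act_iff, not_not]; exact ha
    · rw [affineAct_mul, h1, affineAct_neg, affineAct_mul, affineAct_act_inv,
        affineAct_affineReflection_self, neg_neg]
      exact hs.pos

/-- Peeling a simple reflection `s` off the left of `a` removes the same factor `{1, s}` from both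
sides. -/
lemma Iic_mul_Iic {a b : D.IwahoriWeyl} (h : D.IsReducedMul a b) :
    Set.Iic a * Set.Iic b = Set.Iic (a * b) := by
  induction a using D.left_induction with
  | zero a ha =>
    rw [D.Iic_of_length_eq_zero ha]
    ext x
    rw [mem_singleton_mul, Set.mem_Iic, Set.mem_Iic]
    constructor
    · intro hx
      simpa using D.mul_le_mul_of_length_eq_zero ha hx
    · intro hx
      simpa using D.mul_le_mul_of_length_eq_zero (D.length_inv_eq_zero ha) hx
  | mul i k hs a ha ih =>
    obtain ⟨h1, h2⟩ := IsReducedMul.of_mul_left D hs h ha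
    rw [D.Iic_left hs ha, mul_assoc, ih h1, mul_assoc, D.Iic_left hs h2]

/-- After peeling `s`, either `s a x` or `a x` lies in the lower set `Iic a * B`; since `a x ≤ s a
x`, the second holds in both cases. -/
lemma mem_of_mul_mem {a x : D.IwahoriWeyl} {B : Set D.IwahoriWeyl} (hB : IsLowerSet B)
    (h : D.IsReducedMul a x) (hx : a * x ∈ Set.Iic a * B) : x ∈ B := by
  induction a using D.left_induction with
  | zero a ha =>
    rw [D.Iic_of_length_eq_zero ha, mem_singleton_mul, inv_mul_cancel_left] at hx
    exact hx
  | mul i k hs a ha ih =>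
    obtain ⟨h1, h2⟩ := IsReducedMul.of_mul_left D hs h ha
    apply ih h1
    rw [D.Iic_left hs ha, mul_assoc (D.pair i k), mul_assoc, mem_pair_mul,
      affineReflection_mul_cancel] at hx
    rcases hx with hx | hx
    · exact D.isLowerSet_Iic_mul a hB (D.le_left hs h2) hx
    · exact hx

lemma le_of_mul_le_mul {a x y : D.IwahoriWeyl} (hx : D.IsReducedMul a x)
    (hy : D.IsReducedMul a y) (h : a * x ≤ a * y) : x ≤ y := by
  refine D.mem_of_mul_mem (B := Set.Iic y) (isLowerSet_Iic y) hx ?_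
  rw [D.Iic_mul_Iic hy]
  exact h

/-! ### Cosets of parabolic subgroups -/

/-- If an element of a parabolic subgroup makes a positive affine root negative, it contains the
reflection in this root. -/
lemma affineReflection_mem_closure {K : Set D.IwahoriWeyl} (hK : K ⊆ D.simpleReflections)
    {u : D.IwahoriWeyl} (hu : u ∈ Subgroup.closure K) {i : ι} {k : ℤ}
    (hp : D.IsPosAffineRoot (D.aff i k)) (hn : ¬D.IsPosAffineRoot (D.affineAct u (D.aff i k))) :
    D.affineReflection i k ∈ Subgroup.closure K := by
  have step : ∀ s ∈ K, ∀ y ∈ Subgroup.closure K,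
      (¬D.IsPosAffineRoot (D.affineAct y (D.aff i k)) →
        D.affineReflection i k ∈ Subgroup.closure K) →
      ¬D.IsPosAffineRoot (D.affineAct (s * y) (D.aff i k)) →
        D.affineReflection i k ∈ Subgroup.closure K := by
    intro s hs y hy ih hn
    obtain ⟨j, m, rfl, hsimple⟩ := D.exists_of_mem_simpleReflections (hK hs)
    by_cases h : D.IsPosAffineRoot (D.affineAct y (D.aff i k))
    -- The sign changes exactly at the letter `s`, so `y β` is its affine simple root and `s_β = y⁻¹
    -- s y`.
    · have h1 : D.affineAct y (D.aff i k) = D.aff j m := by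
        by_contra hne
        exact hn (by rw [affineAct_mul]; exact hsimple.act_pos _ h hne)
      have h2 := D.conj_affineReflection h1
      have h3 : D.affineReflection i k = y⁻¹ * (D.affineReflection j m * y) := by
        rw [← h2, inv_mul_cancel_left]
      rw [h3]
      exact mul_mem (inv_mem hy) (mul_mem (Subgroup.subset_closure hs) hy)
    · exact ih h
  induction hu using Subgroup.closure_induction_left with
  | one => rw [affineAct_one] at hn; exact absurd hp hn
  | mul_left s hs y hy ih => exact step s hs y hy ih hn
  | inv_mul_cancel s hs y hy ih =>
    refine step s hs y hy ih ?_
    obtain ⟨j, m, rfl, -⟩ := D.exists_of_mem_simpleReflections (hK hs)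
    rwa [affineReflection_inv] at hn

/-- The elements of a coset of a parabolic subgroup that are below `z` have a greatest element. -/
lemma exists_greatest_in_coset {K : Set D.IwahoriWeyl} (hK : K ⊆ D.simpleReflections)
    (z g : D.IwahoriWeyl) (hne : ∃ x, g⁻¹ * x ∈ Subgroup.closure K ∧ x ≤ z) :
    ∃ m, g⁻¹ * m ∈ Subgroup.closure K ∧ m ≤ z ∧
      ∀ x, g⁻¹ * x ∈ Subgroup.closure K → x ≤ z → x ≤ m := by
  induction z using D.left_induction generalizing g with
  | zero z hz =>
    obtain ⟨x, hx, hxz⟩ := hne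
    obtain rfl := D.eq_of_le_of_length_eq_zero hxz hz
    exact ⟨x, hx, le_rfl, fun y _ hy => hy⟩
  | mul i k hs z hz ih =>
    set s := D.affineReflection i k with hsdef
    have hss : ∀ x, s * (s * x) = x := fun x => D.affineReflection_mul_cancel x i k
    have hle : ∀ x, x ≤ s * z ↔ x ≤ z ∨ s * x ≤ z := fun x => by
      rw [← Set.mem_Iic, D.Iic_left hs hz, mem_pair_mul]; rfl
    obtain ⟨x₀, hx₀, hx₀z⟩ := hne
    rw [hle] at hx₀z
    -- This asks whether `s` stabilizes the coset of `g`. If it does, the larger of `m` and `s m` is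
    -- the greatest element, where `m` is the one for `z`.
    by_cases hc : g⁻¹ * s * g ∈ Subgroup.closure K
    · have hsc : ∀ x, g⁻¹ * x ∈ Subgroup.closure K → g⁻¹ * (s * x) ∈ Subgroup.closure K :=
        fun x hx => by
          have h1 : g⁻¹ * (s * x) = g⁻¹ * s * g * (g⁻¹ * x) := by group
          rw [h1]; exact mul_mem hc hx
      obtain ⟨m, hm, hmz, hmax⟩ := ih g (by
        rcases hx₀z with h | h
        · exact ⟨x₀, hx₀, h⟩
        · exact ⟨s * x₀, hsc _ hx₀, h⟩)
      have hmax' : ∀ x, g⁻¹ * x ∈ Subgroup.closure K → x ≤ s * z →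
          x ∈ D.pair i k * Set.Iic m := by
        intro x hx hxz
        rw [mem_pair_mul]
        exact ((hle x).1 hxz).imp (hmax x hx) (hmax _ (hsc _ hx))
      by_cases hd : D.IsPosAffineRoot (D.affineAct m⁻¹ (D.aff i k))
      · refine ⟨s * m, hsc _ hm, D.left_mul_le hs hz hmz, fun x hx hxz => ?_⟩
        rw [← Set.mem_Iic, D.Iic_left hs hd]
        exact hmax' x hx hxz
      · refine ⟨m, hm, (hle m).2 (Or.inl hmz), fun x hx hxz => ?_⟩
        rw [← Set.mem_Iic, ← D.pair_mul_Iic_of_descent hs hd]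
        exact hmax' x hx hxz
    -- Otherwise `s` is a left descent of all elements of the coset or of none: if `x` and `y`
    -- differed in this, `x⁻¹ s x` would lie in `W_K` and `s` would stabilize the coset.
    · have hsign : ∀ x y, g⁻¹ * x ∈ Subgroup.closure K → g⁻¹ * y ∈ Subgroup.closure K →
          D.IsPosAffineRoot (D.affineAct x⁻¹ (D.aff i k)) →
          D.IsPosAffineRoot (D.affineAct y⁻¹ (D.aff i k)) := by
        intro x y hx hy hpx
        by_contra hny
        obtain ⟨j, m, h1, h2⟩ := D.affineReflection_mul_eq x i k
        rw [← h1, affineAct_inv_act] at hpx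
        have h3 : y⁻¹ * x ∈ Subgroup.closure K := by
          have : y⁻¹ * x = (g⁻¹ * y)⁻¹ * (g⁻¹ * x) := by group
          rw [this]; exact mul_mem (inv_mem hy) hx
        have h4 := D.affineReflection_mem_closure hK h3 hpx (by rwa [affineAct_mul, h1])
        apply hc
        have h5 : g⁻¹ * s * g = (g⁻¹ * x) * D.affineReflection j m * (g⁻¹ * x)⁻¹ := by
          have h6 : s = x * D.affineReflection j m * x⁻¹ := by
            rw [← h2, mul_inv_cancel_right]
          rw [h6]; group
        rw [h5]
        exact mul_mem (mul_mem hx h4) (inv_mem hx)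
      by_cases hd : D.IsPosAffineRoot (D.affineAct x₀⁻¹ (D.aff i k))
      · have hall : ∀ x, g⁻¹ * x ∈ Subgroup.closure K → x ≤ s * z → x ≤ z := fun x hx hxz =>
          ((hle x).1 hxz).elim id fun h => (D.le_left hs (hsign x₀ x hx₀ hx hd)).trans h
        obtain ⟨m, hm, hmz, hmax⟩ := ih g ⟨x₀, hx₀, hall x₀ hx₀ ((hle _).2 hx₀z)⟩
        exact ⟨m, hm, (hle m).2 (Or.inl hmz), fun x hx hxz => hmax x hx (hall x hx hxz)⟩
      -- All elements have the descent `s`, so the problem below `s z` is the image under `s` of the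
      -- problem below `z` for the coset of `s g`.
      · have hneg : ∀ x, g⁻¹ * x ∈ Subgroup.closure K →
            D.IsPosAffineRoot (D.affineAct (s * x)⁻¹ (D.aff i k)) := fun x hx =>
          (D.not_pos_left_iff x i k).1 fun h => hd (hsign x x₀ hx hx₀ h)
        have hall : ∀ x, g⁻¹ * x ∈ Subgroup.closure K → x ≤ s * z → s * x ≤ z := fun x hx hxz =>
          ((hle x).1 hxz).elim
            (fun h => by
              have h1 := D.le_left hs (hneg x hx)
              rw [← hsdef, hss] at h1
              exact h1.trans h) id
        have hco : ∀ x, (s * g)⁻¹ * (s * x) = g⁻¹ * x := fun x => by group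
        obtain ⟨m, hm, hmz, hmax⟩ := ih (s * g)
          ⟨s * x₀, by rwa [hco], hall x₀ hx₀ ((hle _).2 hx₀z)⟩
        have hm' : g⁻¹ * (s * m) ∈ Subgroup.closure K := by rwa [← hco, hss]
        refine ⟨s * m, hm', D.left_mul_le hs hz hmz, fun x hx hxz => ?_⟩
        have h1 := hmax (s * x) (by rwa [hco]) (hall x hx hxz)
        have h2 : D.IsPosAffineRoot (D.affineAct m⁻¹ (D.aff i k)) := by
          have := hneg _ hm'
          rwa [hss] at this
        have h3 := D.left_mul_le hs h2 h1
        rwa [← hsdef, hss] at h3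

end Fintype

/-! ### Translations -/

lemma isPosAffineRoot_aff_mono {i : ι} {k m : ℤ} (h : k ≤ m)
    (hk : D.IsPosAffineRoot (D.aff i k)) : D.IsPosAffineRoot (D.aff i m) := by
  rw [isPosAffineRoot_aff] at hk ⊢
  rcases hk with hk | ⟨hk, hi⟩
  · left; lia
  · right; exact ⟨hk.trans h, hi⟩

lemma affineAct_transl_aff (x : Λ) (i : ι) (k : ℤ) :
    D.affineAct (D.transl x) (D.aff i k) = D.aff i (k - D.root i x) := rfl

lemma transl_inv (x : Λ) : (D.transl x)⁻¹ = D.transl (-x) :=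
  inv_eq_of_mul_eq_one_left (by rw [← transl_add, neg_add_cancel, transl_zero])

-- For an affine simple root, `k` is the least constant that makes `(a, k)` positive, so any
-- decrease of it makes the affine root negative.
variable {D} in
lemma IsSimpleAt.pos_transl_iff {i : ι} {k : ℤ} (hs : D.IsSimpleAt i k) (x : Λ) :
    D.IsPosAffineRoot (D.affineAct (D.transl x) (D.aff i k)) ↔ D.root i x ≤ 0 := by
  rw [affineAct_transl_aff]
  constructor
  · intro h
    by_contra! h'
    exact hs.not_pos_pred (D.isPosAffineRoot_aff_mono (by lia) h)
  · intro h
    exact D.isPosAffineRoot_aff_mono (by lia) hs.pos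

variable {D} in
lemma IsSimpleAt.pos_transl_inv_iff {i : ι} {k : ℤ} (hs : D.IsSimpleAt i k) (x : Λ) :
    D.IsPosAffineRoot (D.affineAct (D.transl x)⁻¹ (D.aff i k)) ↔ 0 ≤ D.root i x := by
  rw [transl_inv, hs.pos_transl_iff, map_neg, neg_nonpos]

lemma affineReflection_mul_transl (i : ι) (k : ℤ) (x : Λ) :
    D.affineReflection i k * D.transl x =
      D.transl (D.reflection i x) * D.affineReflection i k := by
  rw [mul_transl, lin_affineReflection]

lemma root_reflection_self (i : ι) (x : Λ) : D.root i (D.reflection i x) = -D.root i x := by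
  rw [root_apply_reflection, root_reflIdx_self, LinearMap.neg_apply]

lemma reflection_eq_self {i : ι} {x : Λ} (h : D.root i x = 0) : D.reflection i x = x := by
  rw [reflection_apply, h, zero_smul, sub_zero]

lemma isReducedMul_transl {x y : Λ} (h : ∀ i, 0 < D.root i y → 0 ≤ D.root i x) :
    D.IsReducedMul (D.transl x) (D.transl y) := by
  intro p hp hpy hpxy
  obtain ⟨i, hi⟩ := D.exists_aff_of_pos hp
  rw [hi] at hp hpy hpxy
  rw [affineAct_mul, affineAct_transl_aff, affineAct_transl_aff] at hpxy
  rw [affineAct_transl_aff] at hpy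
  have h1 : 0 < D.root i y := by
    by_contra! h'
    exact hpy (D.isPosAffineRoot_aff_mono (by lia) hp)
  have h2 := h i h1
  exact hpy (D.isPosAffineRoot_aff_mono (by lia) hpxy)

/-! ### Dominance with respect to a chamber -/

/-- The roots that are positive at `c` are nonnegative at `x`; for a regular `c` this means that `x`
lies in the closure of the chamber of `c`. -/
def IsDominantFor (c x : Λ) : Prop := ∀ i, 0 < D.root i c → 0 ≤ D.root i x

variable {D} in
lemma IsDominantFor.symm {c x : Λ} (h : D.IsDominantFor c x) : D.IsDominantFor x c := by
  intro i hi
  by_contra! h'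
  have := h (D.negIdx i) (by rw [root_negIdx, LinearMap.neg_apply]; lia)
  rw [root_negIdx, LinearMap.neg_apply] at this
  lia

lemma weyl_root_index {y : Λ ≃ₗ[ℤ] Λ} (hy : y ∈ D.weylGroup) (i : ι) :
    ∃ j, ∀ x, D.root j x = D.root i (y x) := by
  obtain ⟨j, hj, -⟩ := D.exists_weyl_index _ (inv_mem hy) i
  exact ⟨j, fun x => by rw [← hj, show y⁻¹ (y x) = x from y.symm_apply_apply x]⟩

variable {D} in
lemma IsDominant.nonneg {x : Λ} (hx : D.IsDominant x) {i : ι} (hi : D.IsPos i) :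
    0 ≤ D.root i x := by
  suffices ∀ f ∈ D.simpleCone, 0 ≤ f x from this _ hi
  intro f hf
  induction hf using AddSubmonoid.closure_induction with
  | mem f hf => obtain ⟨j, hj, rfl⟩ := hf; exact hx j hj
  | zero => exact le_rfl
  | add f g _ _ hf hg => exact add_nonneg hf hg

section Fintype
variable [Fintype ι]

/-! ### Reduced words -/

/-- The elements that have a reduced word in the simple reflections in `J`. -/
inductive HasReducedWord (J : Set (ι × ℤ)) : D.IwahoriWeyl → Prop
  | one : HasReducedWord J 1
  | mul {w : D.IwahoriWeyl} {i : ι} {k : ℤ} : (i, k) ∈ J →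
      D.IsPosAffineRoot (D.affineAct w (D.aff i k)) → HasReducedWord J w →
      HasReducedWord J (w * D.affineReflection i k)

/-- The exchange property. -/
lemma HasReducedWord.mul_affineReflection {J : Set (ι × ℤ)}
    (hJ : ∀ p ∈ J, D.IsSimpleAt p.1 p.2) {w : D.IwahoriWeyl} (hw : D.HasReducedWord J w)
    {j : ι} {m : ℤ} (hp : D.IsPosAffineRoot (D.aff j m))
    (hn : ¬D.IsPosAffineRoot (D.affineAct w (D.aff j m))) :
    D.HasReducedWord J (w * D.affineReflection j m) := by
  induction h : D.length w using Nat.strong_induction_on generalizing w j m with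
  | _ n ih =>
    cases hw with
    | one => rw [affineAct_one] at hn; exact absurd hp hn
    | @mul w i k hik hpos hw =>
      have hs := hJ _ hik
      by_cases hβ : D.aff j m = D.aff i k
      · rw [D.affineReflection_eq_of_aff hβ, mul_affineReflection_cancel]
        exact hw
      · have h1 := hs.act_pos _ hp hβ
        obtain ⟨j', m', h2, h3⟩ := D.exists_affineAct_aff (D.affineReflection i k) j m
        simp only at h1
        rw [affineAct_mul, h2] at hn
        rw [h2] at h1
        have hl : D.length w < n := h ▸ D.length_lt_mul hs.pos hpos
        have hx := ih _ hl hw h1 hn rfl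
        rw [mul_assoc, h3, ← mul_assoc]
        -- Appending the last letter either lengthens the word or is itself an exchange, for an
        -- element shorter than the original one.
        by_cases hd : D.IsPosAffineRoot
            (D.affineAct (w * D.affineReflection j' m') (D.aff i k))
        · exact HasReducedWord.mul hik hd hx
        · exact ih _ ((D.length_mul_lt h1 hn).trans hl) hx hs.pos hd rfl

lemma hasReducedWord_of_mem_closure {J : Set (ι × ℤ)}
    (hJ : ∀ p ∈ J, D.IsSimpleAt p.1 p.2) {w : D.IwahoriWeyl}
    (hw : w ∈ Subgroup.closure ((fun p : ι × ℤ => D.affineReflection p.1 p.2) '' J)) :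
    D.HasReducedWord J w := by
  have step : ∀ p ∈ J, ∀ w, D.HasReducedWord J w →
      D.HasReducedWord J (w * D.affineReflection p.1 p.2) := by
    intro p hp w hw
    by_cases hd : D.IsPosAffineRoot (D.affineAct w (D.aff p.1 p.2))
    · exact HasReducedWord.mul hp hd hw
    · exact HasReducedWord.mul_affineReflection D hJ hw (hJ p hp).pos hd
  induction hw using Subgroup.closure_induction_right with
  | one => exact HasReducedWord.one
  | mul_right w _ s hs ih => obtain ⟨p, hp, rfl⟩ := hs; exact step p hp _ ih
  | mul_inv_cancel w _ s hs ih =>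
    obtain ⟨p, hp, rfl⟩ := hs
    rw [affineReflection_inv]
    exact step p hp _ ih

/-! ### The Weyl group -/

omit [Fintype ι] in
lemma reflection_negIdx (i : ι) : D.reflection (D.negIdx i) = D.reflection i := by
  ext x; simp [reflection_apply]

/-- The Weyl group is generated by the simple reflections. -/
lemma weylGroup_le : D.weylGroup ≤ Subgroup.closure (D.reflection '' D.base) := by
  have hpos : ∀ i, D.IsPos i → D.reflection i ∈ Subgroup.closure (D.reflection '' D.base) := by
    intro i hi
    -- Induction on height: a simple reflection with positive pairing lowers the value at
    -- `rhoCheck`, and the two root reflections are conjugate under it.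
    induction hn : (D.root i D.rhoCheck).toNat using Nat.strong_induction_on generalizing i with
    | _ n ih =>
      have hex : ∃ j ∈ D.base, 0 < D.root j (D.coroot i) := by
        have key : ∀ f ∈ D.simpleCone, 0 < f (D.coroot i) →
            ∃ j ∈ D.base, 0 < D.root j (D.coroot i) := by
          intro f hf
          induction hf using AddSubmonoid.closure_induction with
          | mem f hf => obtain ⟨j, hj, rfl⟩ := hf; exact fun h => ⟨j, hj, h⟩
          | zero => intro h; simp at h
          | add f g _ _ hf hg =>
            intro h
            rw [LinearMap.add_apply] at h
            by_cases h' : 0 < f (D.coroot i)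
            · exact hf h'
            · exact hg (by lia)
        exact key _ hi (by rw [root_coroot_two]; norm_num)
      obtain ⟨j, hj, hji⟩ := hex
      have hjmem : D.reflection j ∈ Subgroup.closure (D.reflection '' D.base) :=
        Subgroup.subset_closure ⟨j, hj, rfl⟩
      by_cases hij : i = j
      · rw [hij]; exact hjmem
      · have h1 := D.root_coroot_pos_comm hji
        have h2 := D.isPos_reflIdx hj hi hij
        have h3 := h2.rhoCheck_pos
        have h4 := D.root_reflIdx_apply j i D.rhoCheck
        rw [D.root_rhoCheck hj] at h4
        have h5 := ih _ (by lia) (D.reflIdx j i) h2 rfl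
        have h6 : D.reflection i =
            D.reflection j * D.reflection (D.reflIdx j i) * D.reflection j := by
          ext x
          rw [LinearEquiv.mul_apply, LinearEquiv.mul_apply, D.reflection_apply (D.reflIdx j i),
            map_sub, map_smul, coroot_reflIdx_eq, reflection_reflection, reflection_reflection,
            root_apply_reflection, reflIdx_reflIdx, reflection_apply]
        rw [h6]
        exact mul_mem (mul_mem hjmem h5) hjmem
  rw [weylGroup, Subgroup.closure_le]
  rintro _ ⟨i, rfl⟩
  by_cases hi : D.IsPos i
  · exact hpos i hi
  · rw [← reflection_negIdx]
    exact hpos _ ((D.isPos_negIdx_iff i).2 hi)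

/-- Two dominant elements in the same orbit of the Weyl group are equal. -/
lemma eq_of_isDominant {y : Λ ≃ₗ[ℤ] Λ} (hy : y ∈ D.weylGroup) {x : Λ} (hx : D.IsDominant x)
    (hyx : D.IsDominant (y x)) : y x = x := by
  set J : Set (ι × ℤ) := {p | p.1 ∈ D.base ∧ p.2 = 0} with hJdef
  have hJ : ∀ p ∈ J, D.IsSimpleAt p.1 p.2 := by
    rintro ⟨i, k⟩ ⟨hi, hk⟩
    obtain rfl : k = 0 := hk
    exact D.isSimpleAt_base hi
  obtain ⟨w, hw, rfl⟩ : ∃ w ∈ Subgroup.closure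
      ((fun p : ι × ℤ => D.affineReflection p.1 p.2) '' J), D.lin w = y := by
    have hy' := D.weylGroup_le hy
    clear hyx hy
    induction hy' using Subgroup.closure_induction with
    | mem y h =>
      obtain ⟨i, hi, rfl⟩ := h
      exact ⟨_, Subgroup.subset_closure ⟨(i, 0), ⟨hi, rfl⟩, rfl⟩, D.lin_affineReflection i 0⟩
    | one => exact ⟨1, one_mem _, rfl⟩
    | mul y z _ _ ihy ihz =>
      obtain ⟨v, hv, rfl⟩ := ihy
      obtain ⟨w, hw, rfl⟩ := ihz
      exact ⟨v * w, mul_mem hv hw, rfl⟩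
    | inv y _ ih =>
      obtain ⟨w, hw, rfl⟩ := ih
      exact ⟨w⁻¹, inv_mem hw, rfl⟩
  have hred := D.hasReducedWord_of_mem_closure hJ hw
  clear hw hy
  suffices D.shift w = 0 ∧
      ∀ x, D.IsDominant x → D.IsDominant (D.lin w x) → D.lin w x = x from this.2 x hx hyx
  clear hx hyx x
  induction hred with
  | one => exact ⟨rfl, fun x _ _ => rfl⟩
  | @mul w i k hik hpos _ ih =>
    obtain ⟨hi, hk⟩ := hik
    obtain rfl : k = 0 := hk
    refine ⟨by simp [ih.1], fun x hx hwx => ?_⟩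
    obtain ⟨j, hj, -⟩ := D.exists_weyl_index _ (D.lin_mem w) i
    have hjpos : D.IsPos j := by
      have h1 : D.affineAct w (D.aff i 0) = D.aff j 0 := by
        rw [affineAct_eq, ih.1]
        refine Prod.ext (LinearMap.ext fun x => ?_) (by simp)
        rw [LinearMap.comp_apply, aff_fst, aff_fst, ← hj]
        exact congrArg _ ((D.lin w).apply_symm_apply x)
      rw [h1, isPosAffineRoot_aff] at hpos
      simpa using hpos
    rw [lin_mul, lin_affineReflection, LinearEquiv.mul_apply] at hwx ⊢
    -- The last letter being length-increasing, `w a_i` is a positive root; dominance of `w s x`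
    -- gives `-⟨x, a_i⟩ ≥ 0`, so `s` fixes `x` and can be dropped.
    have h2 := hwx.nonneg hjpos
    rw [hj, root_reflection_self] at h2
    have h3 := hx i hi
    rw [D.reflection_eq_self (by lia)] at hwx ⊢
    exact ih.2 x hx hwx

/-- Each element is conjugate to a dominant one. -/
lemma exists_isDominant (x : Λ) : ∃ y ∈ D.weylGroup, D.IsDominant (y x) := by
  -- A point of the orbit maximizing the form against `rhoCheck` is dominant, since reflecting in a
  -- simple root negative on it would increase the form.
  obtain ⟨n, ⟨y, hy, hn⟩, hmax⟩ := Int.exists_greatest_of_bdd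
    (P := fun n => ∃ y ∈ D.weylGroup, D.form (y x) D.rhoCheck = n)
    ⟨D.form x x + D.form D.rhoCheck D.rhoCheck, by
      rintro n ⟨y, hy, rfl⟩
      have h1 := D.two_mul_form_weyl_le hy x D.rhoCheck
      have h2 := D.form_self_nonneg x
      have h3 := D.form_self_nonneg D.rhoCheck
      lia⟩ ⟨_, 1, one_mem _, rfl⟩
  refine ⟨y, hy, fun i hi => ?_⟩
  by_contra! h
  have h1 := hmax _ ⟨D.reflection i * y, mul_mem (D.weylReflection i).2 hy, rfl⟩
  rw [LinearEquiv.mul_apply, reflection_apply, form_sub_left, form_smul_left, hn] at h1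
  have h2 := (D.form_coroot_pos_iff i D.rhoCheck).2 (D.isPos_of_mem_base hi).rhoCheck_pos
  nlinarith

/-- Each orbit of the Weyl group meets a chamber in at most one point. -/
lemma eq_of_isDominantFor {c : Λ} (hc : ∀ i, D.root i c ≠ 0) {x : Λ} {y : Λ ≃ₗ[ℤ] Λ}
    (hy : y ∈ D.weylGroup) (hx : D.IsDominantFor c x) (hyx : D.IsDominantFor c (y x)) :
    y x = x := by
  obtain ⟨u, hu, huc⟩ := D.exists_isDominant c
  have hdom : ∀ z, D.IsDominantFor c z → D.IsDominant (u z) := by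
    intro z hz i hi
    obtain ⟨j, hj⟩ := D.weyl_root_index hu i
    rw [← hj]
    refine hz j (lt_of_le_of_ne ?_ (hc j).symm)
    rw [hj]; exact huc i hi
  have h1 := D.eq_of_isDominant (mul_mem (mul_mem hu hy) (inv_mem hu)) (hdom x hx) (by
    have h2 : (u * y * u⁻¹) (u x) = u (y x) := congrArg (fun z => u (y z)) (u.symm_apply_apply x)
    rw [h2]; exact hdom _ hyx)
  have h2 : (u * y * u⁻¹) (u x) = u (y x) := congrArg (fun z => u (y z)) (u.symm_apply_apply x)
  rw [h2] at h1
  exact u.injective h1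

/-! ### Moving translations through reduced words -/

/-- Both sides are the interval below `s t^x = t^{s x} s`, where `s x` uses the linear part of `s`;
the product is length-increasing in either reading. -/
lemma pair_mul_Iic_transl_of_nonneg {i : ι} {k : ℤ} (hs : D.IsSimpleAt i k) {x : Λ}
    (hx : 0 ≤ D.root i x) :
    D.pair i k * Set.Iic (D.transl x) = Set.Iic (D.transl (D.reflection i x)) * D.pair i k := by
  rw [← D.Iic_left hs ((hs.pos_transl_inv_iff x).2 hx), affineReflection_mul_transl,
    D.Iic_right hs ((hs.pos_transl_iff _).2 (by rw [root_reflection_self]; lia))]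

lemma pair_mul_Iic_transl_of_nonpos {i : ι} {k : ℤ} (hs : D.IsSimpleAt i k) {x : Λ}
    (hx : D.root i x ≤ 0) :
    D.pair i k * Set.Iic (D.transl x) ⊆ Set.Iic (D.transl x) * D.pair i k := by
  rcases hx.eq_or_lt with h | h
  · rw [D.pair_mul_Iic_transl_of_nonneg hs h.ge, D.reflection_eq_self h]
  · rw [D.pair_mul_Iic_of_descent hs fun h' => by rw [hs.pos_transl_inv_iff] at h'; lia]
    exact D.subset_mul_pair i k _

/-- Crossing from right to left: the exponent is reflected when `s` lengthens `t^x` on the right,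
and otherwise `s` is absorbed. -/
lemma Iic_transl_mul_pair_subset {i : ι} {k : ℤ} (hs : D.IsSimpleAt i k) (x : Λ) :
    ∃ y ∈ D.weylGroup, Set.Iic (D.transl x) * D.pair i k ⊆
      D.pair i k * Set.Iic (D.transl (y x)) := by
  by_cases hx : D.root i x ≤ 0
  · refine ⟨D.reflection i, (D.weylReflection i).2, ?_⟩
    rw [D.pair_mul_Iic_transl_of_nonneg hs (by rw [root_reflection_self]; lia),
      reflection_reflection]
  · refine ⟨1, one_mem _, ?_⟩
    rw [D.mul_pair_Iic_of_descent hs fun h => hx ((hs.pos_transl_iff x).1 h)]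
    exact D.subset_pair_mul i k _

omit [Fintype ι] in
lemma mem_admissible {m : Λ} {w : D.IwahoriWeyl} :
    w ∈ D.admissible m ↔ ∃ y ∈ D.weylGroup, w ≤ D.transl (y m) :=
  ⟨fun ⟨y, h⟩ => ⟨y, y.2, h⟩, fun ⟨y, hy, h⟩ => ⟨⟨y, hy⟩, h⟩⟩

omit [Fintype ι] in
lemma isLowerSet_admissible (m : Λ) : IsLowerSet (D.admissible m) :=
  fun _ _ hxy ⟨y, hy⟩ => ⟨y, hxy.trans hy⟩

/-- The admissible set can be moved from the left to the right of a lower interval. -/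
lemma admissible_mul_Iic_subset (m : Λ) (p : D.IwahoriWeyl) :
    D.admissible m * Set.Iic p ⊆ Set.Iic p * D.admissible m := by
  induction p using D.left_induction with
  | zero p hp =>
    rw [D.Iic_of_length_eq_zero hp]
    rintro x ⟨w, hw, q, hq, rfl⟩
    obtain rfl : q = p := hq
    change w * q ∈ _
    obtain ⟨y, hy, hwy⟩ := D.mem_admissible.1 hw
    rw [mem_singleton_mul, mem_admissible]
    refine ⟨_, mul_mem (D.lin_mem q⁻¹) hy, ?_⟩
    have h1 := D.mul_le_mul_of_length_eq_zero (D.length_inv_eq_zero hp)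
      (D.mul_le_mul_right_of_length_eq_zero hp hwy)
    rwa [← mul_assoc, ← mul_assoc, mul_transl, inv_mul_cancel_right, mul_assoc] at h1
  | mul i k hs p hp ih =>
    have h1 : D.admissible m * D.pair i k ⊆ D.pair i k * D.admissible m := by
      rintro _ ⟨w, hw, q, hq, rfl⟩
      obtain ⟨y, hy, hwy⟩ := D.mem_admissible.1 hw
      obtain ⟨z, hz, hsub⟩ := D.Iic_transl_mul_pair_subset hs (y m)
      refine Set.mul_subset_mul_left (fun v hv => ?_) (hsub (Set.mul_mem_mul hwy hq))
      exact D.mem_admissible.2 ⟨z * y, mul_mem hz hy, hv⟩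
    rw [D.Iic_left hs hp, ← mul_assoc, mul_assoc (D.pair i k)]
    refine (Set.mul_subset_mul_right h1).trans ?_
    rw [mul_assoc]
    exact Set.mul_subset_mul_left ih

/-- A translation can be moved from the right to the left of a lower interval; it moves towards
the chamber of `c` if the inversions of `p` are positive at `c`. -/
lemma exists_Iic_mul_Iic_transl_subset {c : Λ} (p : D.IwahoriWeyl)
    (hp : ∀ i k, D.IsPosAffineRoot (D.aff i k) →
      ¬D.IsPosAffineRoot (D.affineAct p (D.aff i k)) → 0 < D.root i c) (x : Λ) :
    ∃ y ∈ D.weylGroup,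
      Set.Iic p * Set.Iic (D.transl x) ⊆ Set.Iic (D.transl (D.lin p (y x))) * Set.Iic p ∧
      ((y x = x ∧ ∀ i k, D.IsPosAffineRoot (D.aff i k) →
        ¬D.IsPosAffineRoot (D.affineAct p (D.aff i k)) → 0 ≤ D.root i x) ∨
        D.form x c < D.form (y x) c) := by
  induction p using D.left_induction with
  | zero p h0 =>
    refine ⟨1, one_mem _, ?_, Or.inl ⟨rfl, fun i k h h' =>
      absurd ((D.pos_act_iff_of_length_eq_zero h0 _).2 h) h'⟩⟩
    rw [D.Iic_of_length_eq_zero h0]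
    intro v hv
    rw [mem_singleton_mul, Set.mem_Iic] at hv
    refine Set.mem_mul.2 ⟨v * p⁻¹, ?_, p, rfl, inv_mul_cancel_right v p⟩
    have h1 := D.mul_le_mul_right_of_length_eq_zero (D.length_inv_eq_zero h0)
      (D.mul_le_mul_of_length_eq_zero h0 hv)
    rwa [mul_inv_cancel_left, mul_transl, mul_inv_cancel_right] at h1
  | mul i k hs p hpos ih =>
    obtain ⟨j, m, hjm, -⟩ := D.exists_affineAct_aff p⁻¹ i k
    have hpj : D.affineAct p (D.aff j m) = D.aff i k := by rw [← hjm, affineAct_act_inv]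
    have hlin : ∀ z, D.root i (D.lin p z) = D.root j z := by
      intro z
      have h1 := congrArg Prod.fst hpj
      rw [affineAct_eq, aff_fst, aff_fst] at h1
      rw [← h1]
      exact congrArg _ ((D.lin p).symm_apply_apply z)
    have hconj : ∀ z, D.lin p (D.reflection j z) = D.reflection i (D.lin p z) := by
      intro z
      have h1 := congrArg D.lin (D.conj_affineReflection hpj)
      rw [lin_mul, lin_mul, lin_affineReflection, lin_affineReflection] at h1
      exact congrArg (fun f : Λ ≃ₗ[ℤ] Λ => f z) h1
    rw [hjm] at hpos
    have hjinv : ¬D.IsPosAffineRoot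
        (D.affineAct (D.affineReflection i k * p) (D.aff j m)) := by
      rw [affineAct_mul, hpj, affineAct_affineReflection_self, isPosAffineRoot_neg_aff, not_not]
      exact hs.pos
    have hjc := hp j m hpos hjinv
    have hinv : ∀ a b, D.IsPosAffineRoot (D.aff a b) →
        ¬D.IsPosAffineRoot (D.affineAct p (D.aff a b)) →
        ¬D.IsPosAffineRoot (D.affineAct (D.affineReflection i k * p) (D.aff a b)) := by
      intro a b hab hn hn'
      obtain ⟨a', b', h1, -⟩ := D.exists_affineAct_aff p a b
      rw [not_pos_act_iff, h1] at hn
      rw [affineAct_mul, h1] at hn'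
      by_cases h2 : -D.aff a' b' = D.aff i k
      · have h3 : D.aff a b = -D.aff j m := by
          apply D.affineAct_injective p
          rw [h1, affineAct_neg, hpj, ← h2, neg_neg]
        rw [h3, isPosAffineRoot_neg_aff] at hab
        exact hab hpos
      · have h3 := hs.act_pos _ hn h2
        rw [affineAct_neg, ← not_pos_act_iff] at h3
        exact h3 hn'
    have hinv' : ∀ a b, D.IsPosAffineRoot (D.aff a b) →
        ¬D.IsPosAffineRoot (D.affineAct (D.affineReflection i k * p) (D.aff a b)) →
        ¬D.IsPosAffineRoot (D.affineAct p (D.aff a b)) ∨ D.aff a b = D.aff j m := by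
      intro a b hab hn
      by_cases h1 : D.IsPosAffineRoot (D.affineAct p (D.aff a b))
      · right
        rw [affineAct_mul] at hn
        by_contra hne
        exact hn (hs.act_pos _ h1 fun h2 => hne (D.affineAct_injective p (h2.trans hpj.symm)))
      · exact Or.inl h1
    obtain ⟨y, hy, hsub, hy'⟩ := ih fun a b hab hn => hp a b hab (hinv a b hab hn)
    have hmain : ∀ z, D.pair i k * Set.Iic (D.transl (D.lin p (y x))) ⊆
        Set.Iic (D.transl z) * D.pair i k →
        Set.Iic (D.affineReflection i k * p) * Set.Iic (D.transl x) ⊆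
          Set.Iic (D.transl z) * Set.Iic (D.affineReflection i k * p) := by
      intro z hz
      rw [D.Iic_left hs (by rwa [hjm]), mul_assoc, ← mul_assoc (Set.Iic (D.transl z))]
      refine (Set.mul_subset_mul_left hsub).trans ?_
      rw [← mul_assoc]
      exact Set.mul_subset_mul_right hz
    -- If the pairing is nonnegative, the exponent follows the linear part of the longer element.
    -- Otherwise `s` is absorbed or commutes, so relative to that linear part the exponent is
    -- reflected in `a_j`; this raises the form against `c` since `⟨c, a_j⟩ > 0`.
    by_cases hneg : 0 ≤ D.root j (y x)
    · refine ⟨y, hy, hmain _ ?_, hy'.imp_left fun h => ⟨h.1, fun a b hab hn => ?_⟩⟩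
      · rw [lin_mul, lin_affineReflection, LinearEquiv.mul_apply]
        exact (D.pair_mul_Iic_transl_of_nonneg hs (by rwa [hlin])).le
      · rcases hinv' a b hab hn with h1 | h1
        · exact h.2 a b hab h1
        · have h2 : D.root a = D.root j := congrArg Prod.fst h1
          rw [h2, ← h.1]; exact hneg
    · refine ⟨D.reflection j * y, mul_mem (D.weylReflection j).2 hy, hmain _ ?_, Or.inr ?_⟩
      · rw [lin_mul, lin_affineReflection, LinearEquiv.mul_apply, LinearEquiv.mul_apply, hconj,
          reflection_reflection]
        exact D.pair_mul_Iic_transl_of_nonpos hs (by rw [hlin]; lia)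
      · rw [LinearEquiv.mul_apply, reflection_apply, form_sub_left, form_smul_left]
        have h1 := (D.form_coroot_pos_iff j c).2 hjc
        have h2 : D.form x c ≤ D.form (y x) c := by
          rcases hy' with h | h
          · rw [h.1]
          · exact h.le
        nlinarith

lemma exists_Iic_transl_mul_subset (c x : Λ) : ∃ y ∈ D.weylGroup,
    Set.Iic (D.transl c) * Set.Iic (D.transl x) ⊆
      Set.Iic (D.transl (y x)) * Set.Iic (D.transl c) ∧
    (D.IsDominantFor c (y x) ∨ D.form x c < D.form (y x) c) := by
  obtain ⟨y, hy, h1, h2⟩ := D.exists_Iic_mul_Iic_transl_subset (c := c) (D.transl c) (by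
    intro i k hp hn
    rw [affineAct_transl_aff] at hn
    by_contra! h
    exact hn (D.isPosAffineRoot_aff_mono (by lia) hp)) x
  refine ⟨y, hy, h1, h2.imp_left fun h => ?_⟩
  rw [h.1]
  intro i hi
  -- Every root positive at `c` occurs in an inversion of `t^c`; the least constant for which it is
  -- a positive affine root, 0 or 1, provides one.
  by_cases hip : D.IsPos i
  · refine h.2 i 0 (by rw [isPosAffineRoot_aff]; tauto) ?_
    rw [affineAct_transl_aff, isPosAffineRoot_aff]; lia
  · refine h.2 i 1 (by rw [isPosAffineRoot_aff]; tauto) ?_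
    rw [affineAct_transl_aff, isPosAffineRoot_aff]; lia

lemma Iic_transl_mul_Iic_transl {c x : Λ} (h : D.IsDominantFor c x) :
    Set.Iic (D.transl x) * Set.Iic (D.transl c) = Set.Iic (D.transl (x + c)) := by
  rw [D.Iic_mul_Iic (D.isReducedMul_transl h), transl_add]

omit [Fintype ι] in
lemma isDominantFor_nsmul (c : Λ) (n : ℕ) : D.IsDominantFor (n • c) c := by
  intro i hi
  rw [map_nsmul, nsmul_eq_mul] at hi
  exact (pos_of_mul_pos_right hi (Int.natCast_nonneg n)).le

lemma Iic_transl_succ (c : Λ) (n : ℕ) : Set.Iic (D.transl ((n + 1) • c)) =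
    Set.Iic (D.transl c) * Set.Iic (D.transl (n • c)) := by
  rw [D.Iic_transl_mul_Iic_transl (D.isDominantFor_nsmul c n), succ_nsmul']

/-- Each factor `t^c` crossed raises the integer-valued form by at least 1, until the exponent is in
the chamber of `c`; from then on intervals commute. -/
lemma exists_Iic_transl_nsmul_mul_subset (c x : Λ) (n : ℕ) : ∃ y ∈ D.weylGroup,
    Set.Iic (D.transl (n • c)) * Set.Iic (D.transl x) ⊆
      Set.Iic (D.transl (y x)) * Set.Iic (D.transl (n • c)) ∧
    (D.IsDominantFor c (y x) ∨ D.form x c + n ≤ D.form (y x) c) := by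
  induction n with
  | zero =>
    refine ⟨1, one_mem _, ?_, Or.inr (by simp)⟩
    rw [zero_nsmul, transl_zero, D.Iic_of_length_eq_zero (a := 1)
      ((D.length_eq_zero_iff 1).2 fun p hp => by rwa [affineAct_one])]
    simp
  | succ n ih =>
    obtain ⟨y, hy, hsub, hy'⟩ := ih
    have hmain : ∀ z, Set.Iic (D.transl c) * Set.Iic (D.transl (y x)) ⊆
        Set.Iic (D.transl z) * Set.Iic (D.transl c) →
        Set.Iic (D.transl ((n + 1) • c)) * Set.Iic (D.transl x) ⊆
          Set.Iic (D.transl z) * Set.Iic (D.transl ((n + 1) • c)) := by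
      intro z hz
      rw [Iic_transl_succ, mul_assoc, ← mul_assoc (Set.Iic (D.transl z))]
      refine (Set.mul_subset_mul_left hsub).trans ?_
      rw [← mul_assoc]
      exact Set.mul_subset_mul_right hz
    by_cases hdom : D.IsDominantFor c (y x)
    · refine ⟨y, hy, hmain _ ?_, Or.inl hdom⟩
      rw [D.Iic_transl_mul_Iic_transl hdom, D.Iic_transl_mul_Iic_transl hdom.symm, add_comm]
    · obtain ⟨z, hz, hsub', hz'⟩ := D.exists_Iic_transl_mul_subset c (y x)
      refine ⟨z * y, mul_mem hz hy, hmain _ hsub', hz'.imp_right fun h => ?_⟩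
      have h1 := hy'.resolve_left hdom
      rw [LinearEquiv.mul_apply]
      push_cast
      lia

/-- For large `n`, a translation moved across the interval below `t^{nc}` ends in the chamber of
`c`. -/
lemma exists_isDominantFor_Iic_mul_subset (c x : Λ) {n : ℕ}
    (hn : D.form x x + D.form c c < n) : ∃ y ∈ D.weylGroup, D.IsDominantFor c (y x) ∧
    Set.Iic (D.transl (n • c)) * Set.Iic (D.transl x) ⊆
      Set.Iic (D.transl (y x)) * Set.Iic (D.transl (n • c)) := by
  obtain ⟨y, hy, hsub, hdom⟩ := D.exists_Iic_transl_nsmul_mul_subset c x n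
  refine ⟨y, hy, hdom.resolve_right fun h => ?_, hsub⟩
  -- The orbit bound at `x` and at `-x` limits the total gain to the sum of the two squares, which
  -- is less than `n`.
  have h1 := D.two_mul_form_weyl_le hy x c
  have h2 := D.two_mul_form_weyl_le (one_mem _) ((-1 : ℤ) • x) c
  simp only [LinearEquiv.coe_one, id_eq, form_smul_left, form_smul_right] at h2
  lia

/-! ### Chambers adapted to a coset -/

/-- For each `z` there is a regular `c` such that `t^{nc} z` is a reduced product for all `n`. -/
lemma exists_regular_isReducedMul (z : D.IwahoriWeyl) : ∃ c : Λ, (∀ i, D.root i c ≠ 0) ∧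
    ∀ n : ℕ, D.IsReducedMul (D.transl (n • c)) z := by
  -- With `o` the base point, `d` is `rhoBound` times `z(o) - o`. Adding `rhoCheck` to a large
  -- multiple of `d` makes `c` regular without changing nonzero signs.
  set d : Λ := D.lin z D.rhoCheck + D.rhoBound • D.shift z - D.rhoCheck with hd
  set c : Λ := D.rhoBound • d + D.rhoCheck with hc
  have hrc : ∀ j, D.root j c = D.rhoBound * D.root j d + D.root j D.rhoCheck := fun j => by
    simp [hc]
  have hb : ∀ j, -D.rhoBound < D.root j D.rhoCheck ∧ D.root j D.rhoCheck < D.rhoBound :=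
    fun j => abs_lt.1 (D.abs_root_rhoCheck_lt j)
  have hpos : ∀ j, 0 < D.root j d → 0 < D.root j c := fun j h => by
    have := hb j; rw [hrc]; nlinarith
  refine ⟨c, fun j => ?_, fun n p hp hn hn' => ?_⟩
  · rcases lt_trichotomy (D.root j d) 0 with h | h | h
    · have := hb j; rw [hrc]; nlinarith
    · rw [hrc, h, mul_zero, zero_add]; exact D.root_rhoCheck_ne_zero j
    · exact (hpos j h).ne'
  · obtain ⟨i, hi⟩ := D.exists_aff_of_pos hp
    rw [hi] at hp hn hn'
    generalize p.2 = k at hp hn hn'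
    obtain ⟨j, hj, -⟩ := D.exists_weyl_index _ (D.lin_mem z) i
    have h0 : ∀ x, D.root i ((D.lin z).symm x) = D.root j x := fun x => by
      rw [← hj, LinearEquiv.apply_symm_apply]
    have h1 : D.affineAct z (D.aff i k) = D.aff j (k - D.root j (D.shift z)) := by
      rw [affineAct_eq]
      refine Prod.ext (LinearMap.ext fun x => h0 x) ?_
      simp [h0]
    rw [affineAct_mul, h1, affineAct_transl_aff] at hn'
    rw [h1] at hn
    have h2 := D.eval_pos hp
    have h3 := mt (D.eval_aff_pos_iff _ _).1 hn
    rw [eval_apply, aff_fst, aff_snd] at h2 h3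
    -- For an inversion, the image affine root is positive at `z(o)` and negative at `o`, so its
    -- linear part increases along `d`; translating by `n c` lowers the constant further.
    have h4 : 0 < D.root j d := by
      rw [hd, map_sub, map_add, map_smul, hj, smul_eq_mul]
      push Not at h3
      nlinarith
    have h5 := hpos j h4
    refine hn (D.isPosAffineRoot_aff_mono ?_ hn')
    rw [map_nsmul, nsmul_eq_mul]
    have : 0 ≤ (n : ℤ) * D.root j c := by positivity
    lia

/-- If `z` has maximal length in its coset, `az` being reduced implies that `ax` is reduced for all
`x` in the coset. -/
lemma isReducedMul_of_coset {K : Set D.IwahoriWeyl} (hK : K ⊆ D.simpleReflections)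
    {a z x : D.IwahoriWeyl} (hz : ∀ u ∈ Subgroup.closure K, D.length (z * u) ≤ D.length z)
    (hx : z⁻¹ * x ∈ Subgroup.closure K) (h : D.IsReducedMul a z) : D.IsReducedMul a x := by
  intro p hp hn
  set u := z⁻¹ * x with hu
  have hzu : x = z * u := by rw [hu, mul_inv_cancel_left]
  obtain ⟨i, hi⟩ := D.exists_aff_of_pos hp
  rw [hi] at hp hn ⊢
  generalize p.2 = k at hp hn ⊢
  rw [hzu, affineAct_mul] at hn
  rw [hzu, ← mul_assoc, affineAct_mul]
  by_cases hup : D.IsPosAffineRoot (D.affineAct u (D.aff i k))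
  · exact h _ hup hn
  · exfalso
    -- If `u β` were negative, the reflection in `-u β` would lie in `W_K` while `z` keeps `-u β`
    -- positive, giving a longer element of the coset of `z`.
    have hr := D.affineReflection_mem_closure hK hx hp hup
    obtain ⟨j, m, h1, h2⟩ := D.exists_affineAct_aff u i k
    rw [h1] at hup hn
    have h3 : D.affineReflection j m ∈ Subgroup.closure K := by
      have h4 : D.affineReflection j m = u * D.affineReflection i k * u⁻¹ := by
        rw [h2, mul_inv_cancel_right]
      rw [h4]; exact mul_mem (mul_mem hx hr) (inv_mem hx)
    rw [← isPosAffineRoot_neg_aff, neg_aff] at hup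
    rw [not_pos_act_iff, ← affineAct_neg, neg_aff] at hn
    have h5 := D.length_lt_mul hup hn
    rw [affineReflection_negIdx] at h5
    exact absurd (hz _ h3) (not_le.2 h5)

/-- The intersection of an admissible set with a coset of a finite parabolic subgroup has a
greatest element. -/
lemma exists_isGreatest_coset_inter_admissible (μ : Λ) {K : Set D.IwahoriWeyl}
    (hK : D.IsSpherical K) {w : D.IwahoriWeyl} (hw : w ∈ D.admissible μ) :
    ∃ u, IsGreatest (w • (Subgroup.closure K : Set D.IwahoriWeyl) ∩ D.admissible μ) u := by
  obtain ⟨hKs, hfin⟩ := hK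
  obtain ⟨v, hv, hmax⟩ := Set.exists_max_image (Subgroup.closure K : Set D.IwahoriWeyl)
    (fun v => D.length (w * v)) hfin ⟨1, one_mem _⟩
  have hmem : ∀ x, x ∈ w • (Subgroup.closure K : Set D.IwahoriWeyl) ↔
      w⁻¹ * x ∈ Subgroup.closure K := fun x => by
    rw [Set.mem_smul_set_iff_inv_smul_mem]; rfl
  obtain ⟨c, hc, hcz⟩ := D.exists_regular_isReducedMul (w * v)
  have hred : ∀ n : ℕ, ∀ x, w⁻¹ * x ∈ Subgroup.closure K →
      D.IsReducedMul (D.transl (n • c)) x := by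
    intro n x hx
    refine D.isReducedMul_of_coset hKs (fun u hu => ?_) ?_ (hcz n)
    · rw [mul_assoc]; exact hmax _ (mul_mem hv hu)
    · rw [mul_inv_rev, mul_assoc]; exact mul_mem (inv_mem hv) hx
  obtain ⟨n, hn⟩ : ∃ n : ℕ, D.form μ μ + D.form c c < n :=
    ⟨(D.form μ μ + D.form c c + 1).toNat, by lia⟩
  obtain ⟨y₀, hy₀, hdom, -⟩ := D.exists_isDominantFor_Iic_mul_subset c μ hn
  set p := D.transl (n • c) with hp
  have hfwd : ∀ x ∈ D.admissible μ, p * x ≤ D.transl (y₀ μ) * p := by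
    intro x hx
    obtain ⟨y, hy, hxy⟩ := D.mem_admissible.1 hx
    obtain ⟨z, hz, hdom', hsub⟩ := D.exists_isDominantFor_Iic_mul_subset c (y μ) (n := n)
      (by rwa [D.form_weyl hy])
    -- Regularity of `c` makes the endpoint independent of the translation that bounds `x`, so one
    -- interval serves for the whole admissible set.
    have h1 : z (y μ) = y₀ μ := by
      have h2 := D.eq_of_isDominantFor hc (mul_mem (mul_mem hz hy) (inv_mem hy₀)) hdom (by
        have : (z * y * y₀⁻¹) (y₀ μ) = z (y μ) :=
          congrArg (fun a => z (y a)) (y₀.symm_apply_apply μ)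
        rwa [this])
      rw [← h2]
      exact (congrArg (fun a => z (y a)) (y₀.symm_apply_apply μ)).symm
    rw [h1] at hsub
    have h3 := hsub (Set.mul_mem_mul Set.self_mem_Iic hxy)
    rwa [D.Iic_mul_Iic] at h3
    refine D.isReducedMul_transl fun i hi => hdom i ?_
    rw [map_nsmul, nsmul_eq_mul] at hi
    exact pos_of_mul_pos_right hi (Int.natCast_nonneg n)
  have hbwd : ∀ x, w⁻¹ * x ∈ Subgroup.closure K → p * x ≤ D.transl (y₀ μ) * p →
      x ∈ D.admissible μ := by
    intro x hx hle
    -- The interval below `t^{y₀ μ} p` factors, so `p x` lies in `Adm(μ) * Iic p ⊆ Iic p * Adm(μ)`;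
    -- then `p` is cancelled, as `p x` is reduced.
    refine D.mem_of_mul_mem (D.isLowerSet_admissible μ) (hred n x hx)
      (D.admissible_mul_Iic_subset μ p ?_)
    have h1 : p * x ∈ Set.Iic (D.transl (y₀ μ)) * Set.Iic p := by
      rw [D.Iic_mul_Iic]
      · exact hle
      · refine D.isReducedMul_transl fun i hi => hdom i ?_
        rw [map_nsmul, nsmul_eq_mul] at hi
        exact pos_of_mul_pos_right hi (Int.natCast_nonneg n)
    exact Set.mul_subset_mul_right (fun b hb => D.mem_admissible.2 ⟨y₀, hy₀, hb⟩) h1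
  have hcos : ∀ x, (p * w)⁻¹ * (p * x) = w⁻¹ * x := fun x => by group
  obtain ⟨m, hm, hmz, hgr⟩ := D.exists_greatest_in_coset hKs (D.transl (y₀ μ) * p) (p * w)
    ⟨p * w, by simp [one_mem], hfwd w hw⟩
  obtain ⟨u, rfl⟩ : ∃ u, m = p * u := ⟨p⁻¹ * m, by group⟩
  rw [hcos] at hm
  refine ⟨u, ⟨(hmem u).2 hm, hbwd u hm hmz⟩, fun x hx => ?_⟩
  have hx1 := (hmem x).1 hx.1
  exact D.le_of_mul_le_mul (hred n x hx1) (hred n u hm)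
    (hgr _ (by rwa [hcos]) (hfwd x hx.2))

end Fintype

end BasedRootDatum

end

theorem proposition2 {ι Λ : Type*} [Finite ι] [AddCommGroup Λ] [Module.Finite ℤ Λ]
    (D : BasedRootDatum ι Λ) (μ : Λ) (hμ : D.IsDominant μ)
    (K : Set D.IwahoriWeyl) (hK : D.IsSpherical K)
    (w : D.IwahoriWeyl) (hw : w ∈ D.admissible μ) :
    ∃! u : D.IwahoriWeyl,
      Maximal (fun v => v ∈ w • (Subgroup.closure K : Set D.IwahoriWeyl) ∩ D.admissible μ) u := by
  cases nonempty_fintype ι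
  obtain ⟨u, hu⟩ := D.exists_isGreatest_coset_inter_admissible μ hK hw
  refine ⟨u, ⟨hu.1, fun v hv _ => hu.2 hv⟩, fun v hv => ?_⟩
  exact le_antisymm (hu.2 hv.1) (hv.2 hu.1 (hu.2 hv.1))
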